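/- Let $M$ be a Riemann surface and let $\mathbb{H}=\mathbb{R}^4$ be the quaternions, embedded in the quaternionic projective line by $x\mapsto[(x,1)]$, so that $\mathbb{H}=\mathbb{HP}^1\setminus\{\infty\}$ with $\infty=[(1,0)]$. For a 1-form $\alpha$ on $M$ write $(*\alpha)(X)=\alpha(iX)$. Let $f\colon M\to\mathbb{H}$ be a smooth conformal immersion. Its left and right normals are the maps $N,R\colon M\to S^2\subset\operatorname{Im}\mathbb{H}$ with $*df=N\,df=-df\,R$. A map $n\colon M\to S^2\subset\operatorname{Im}\mathbb{H}$ is harmonic if it is smooth and the 2-form $d{*}dn$ is normal to $S^2$, that is, pointwise a real multiple of $n$. Let $V=\mathbb{H}^2$, regarded as a right quaternionic vector space and as the trivial bundle $M\times V$ with the trivial connection $\nabla=d$. Let $L\subset V$ be the line subbundle with fibres $L_p=(f(p),1)\mathbb{H}$, let $\pi\colon V\to V/L$ be the projection, and let $\delta=\pi\nabla|_L$. The mean curvature sphere congruence of $f$ is the unique smooth $S\colon M\to\operatorname{End}(V)$ with $S^2=-1$, $SL=L$, $*\delta=S\delta=\delta S$ and $Q|_L=0$, where $A=\frac14(S\nabla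 S+*\nabla S)$ and $Q=\frac14(S\nabla S-*\nabla S)$ are the Hopf fields of $S$. Let $\Omega^1(\mathcal{R})$ be the space of smooth 1-forms on $M$ with values in $\mathcal{R}=\{B\in\operatorname{End}(V) : \operatorname{im}B\subset L\subset\ker B\}$. The immersion $f$ is called constrained Willmore if it satisfies the Euler-Lagrange equation $d^\nabla(2{*}A+\eta)=0$ for some Lagrange multiplier $\eta\in\Omega^1(\mathcal{R})$. Then $N$, $R$ and $S$ exist and are unique, and the following holds. a) The right normal $R$ is harmonic if and only if $f$ is constrained Willmore and there is $\eta\in\Omega^1(\mathcal{R})$ such that $2{*}A+\eta$ is closed and vanishes on the line $(1,0)\mathbb{H}\subset V$ corresponding to $\infty$. b) The left normal $N$ is harmonic if and only if $f$ is constrained Willmore and there is $\eta\in\Omega^1(\mathcal{R})$ such that $2{*}Q+\eta$ is closed and takes values in the line $(1,0)\mathbb{H}$ corresponding to $\infty$ (that is, for every tangent vector the image of the endomorphism is contained in that line). -/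

import Mathlib

open scoped Manifold ContDiff Quaternion

noncomputable section

namespace QuatSurface

/-! ### Differential forms on a Riemann surface

A Riemann surface is a manifold `M` modelled on `ℂ` with holomorphic coordinate changes.  In Mathlib
the tangent space at `p`, `TangentSpace 𝓘(ℝ, ℂ) p`, is by definition `ℂ`, by means of the preferred
chart at `p`.  As coordinate changes are holomorphic, multiplication by `i` on the tangent space
does not depend on the chart. -/

section Forms

variable {M : Type*} [TopologicalSpace M] [ChartedSpace ℂ M]
variable {W : Type*} [NormedAddCommGroup W] [NormedSpace ℝ W]

/-- Real 1-forms on `M` (not necessarily smooth) with values in the real vector space `W`; the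
tangent space at each point is `ℂ`, as above. -/
abbrev OneForm (M W : Type*) [NormedAddCommGroup W] [NormedSpace ℝ W] : Type _ :=
  M → ℂ →L[ℝ] W

/-- `(*α)(X) = α (i X)`. -/
def starForm (α : OneForm M W) : OneForm M W :=
  fun p => (α p).comp (Complex.I • ContinuousLinearMap.id ℝ ℂ)

/-- The differential of a vector valued function. -/
def d (F : M → W) : OneForm M W := fun p => mfderiv 𝓘(ℝ, ℂ) 𝓘(ℝ, W) F p

/-- The 1-form `α` in the coordinate given by the preferred chart at `p`, that is, its pull back
by the inverse of that chart. -/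
def inChart (p : M) (α : OneForm M W) (z : ℂ) : ℂ →L[ℝ] W :=
  (α ((chartAt ℂ p).symm z)).comp (mfderiv 𝓘(ℝ, ℂ) 𝓘(ℝ, ℂ) (chartAt ℂ p).symm z)

/-- A 1-form is smooth if its coefficients in charts are smooth. -/
def IsSmoothForm (α : OneForm M W) : Prop :=
  ∀ p : M, ContDiffOn ℝ ∞ (inChart p α) (chartAt ℂ p).target

/-- The exterior derivative `(dα)_p (X, Y) = ∂_X (α Y) - ∂_Y (α X)`, computed in the preferred
chart at `p`, with `X` and `Y` extended constantly in that chart. -/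
def extD (α : OneForm M W) (p : M) (X Y : ℂ) : W :=
  fderiv ℝ (inChart p α) (chartAt ℂ p p) X Y - fderiv ℝ (inChart p α) (chartAt ℂ p p) Y X

def IsClosedForm (α : OneForm M W) : Prop := ∀ p X Y, extD α p X Y = 0

end Forms

section Surfaces

variable {M : Type*} [TopologicalSpace M] [ChartedSpace ℂ M]

/-! ### Surfaces in Euclidean 4-space `ℍ` and harmonic maps to the 2-sphere -/

/-- Smooth immersions into `ℍ = ℝ⁴` that are conformal with respect to the complex structure of
`M`: at each point the differential is a nonzero multiple of an isometric embedding of `ℂ`. -/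
def IsConformalImmersion (f : M → ℍ[ℝ]) : Prop :=
  ContMDiff 𝓘(ℝ, ℂ) 𝓘(ℝ, ℍ[ℝ]) ∞ f ∧ ∀ p : M, IsConformalMap (d f p)

/-- The unit 2-sphere in the imaginary quaternions. -/
def imSphere : Set ℍ[ℝ] := {a | a.re = 0 ∧ ‖a‖ = 1}

/-- `N : M → S² ⊂ Im ℍ` is the left normal of `f`: `*df = N df`. -/
def IsLeftNormal (f N : M → ℍ[ℝ]) : Prop :=
  (∀ p, N p ∈ imSphere) ∧ ∀ p X, starForm (d f) p X = N p * d f p X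

/-- `R : M → S² ⊂ Im ℍ` is the right normal of `f`: `*df = - df R`. -/
def IsRightNormal (f R : M → ℍ[ℝ]) : Prop :=
  (∀ p, R p ∈ imSphere) ∧ ∀ p X, starForm (d f) p X = -(d f p X * R p)

/-- Harmonic maps into the unit 2-sphere: the 2-form `d*dN` is normal to the sphere, that is, at
each point it is a real multiple of `N`. -/
def IsHarmonic (N : M → ℍ[ℝ]) : Prop :=
  (∀ p, N p ∈ imSphere) ∧ ContMDiff 𝓘(ℝ, ℂ) 𝓘(ℝ, ℍ[ℝ]) ∞ N ∧
    ∀ p X Y, ∃ r : ℝ, extD (starForm (d N)) p X Y = r • N p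

/-! ### Surfaces in the conformal 4-sphere `ℍP¹`

`V = ℍ²` is a right quaternionic vector space, that is, a module over `ℍᵐᵒᵖ`.  The trivial bundle
`M × V` carries the trivial connection `∇ = d`. -/

abbrev V : Type := Fin 2 → ℍ[ℝ]

/-- Real endomorphisms of `V`, a normed algebra.  The endomorphisms of the quaternionic vector space
`V` are the elements of the real subspace singled out by `IsQuatLinear`. -/
abbrev EndV : Type := V →L[ℝ] V

/-- `B ∈ End(V)`: `B` is linear over the quaternions, acting from the right. -/
def IsQuatLinear (B : EndV) : Prop := ∀ (a : ℍ[ℝ]ᵐᵒᵖ) (v : V), B (a • v) = a • B v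

/-- The point `∞ = [(1, 0)]` of `ℍP¹`. -/
def lineInfty : Submodule ℍ[ℝ]ᵐᵒᵖ V := Submodule.span ℍ[ℝ]ᵐᵒᵖ {![1, 0]}

/-- The line bundle of `f : M → ℍ = ℍP¹ \ {∞}`, with fibre `[(f p, 1)]` over `p`. -/
def line (f : M → ℍ[ℝ]) (p : M) : Submodule ℍ[ℝ]ᵐᵒᵖ V := Submodule.span ℍ[ℝ]ᵐᵒᵖ {![f p, 1]}

/-- The product of an endomorphism field with an endomorphism valued 1-form. -/
def fieldMul (S : M → EndV) (α : OneForm M EndV) : OneForm M EndV :=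
  fun p => (ContinuousLinearMap.compL ℝ V V V (S p)).comp (α p)

/-- The Hopf field `A = ¼ (S∇S + *∇S)`. -/
def hopfA (S : M → EndV) : OneForm M EndV := (1 / 4 : ℝ) • (fieldMul S (d S) + starForm (d S))

/-- The Hopf field `Q = ¼ (S∇S - *∇S)`. -/
def hopfQ (S : M → EndV) : OneForm M EndV := (1 / 4 : ℝ) • (fieldMul S (d S) - starForm (d S))

/-- Smooth sections of the line bundle `L ⊂ M × V` of `f`. -/
def IsSection (f : M → ℍ[ℝ]) (ψ : M → V) : Prop :=
  ContMDiff 𝓘(ℝ, ℂ) 𝓘(ℝ, V) ∞ ψ ∧ ∀ p, ψ p ∈ line f p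

/-- `S` is the mean curvature sphere congruence of `f`: a smooth field of endomorphisms of `V` with
`S² = -1`, `SL = L`, `*δ = Sδ = δS` and `Q|_L = 0`.  Here `δ ψ = π(∇ψ)` for sections `ψ` of `L`,
with `π : V → V/L` the projection, so that identities between values of `δ` are identities in `V`
modulo `L`. -/
structure IsMeanCurvatureSphere (f : M → ℍ[ℝ]) (S : M → EndV) : Prop where
  smooth : ContMDiff 𝓘(ℝ, ℂ) 𝓘(ℝ, EndV) ∞ S
  quatLinear : ∀ p, IsQuatLinear (S p)
  sq : ∀ p, S p * S p = -1
  map_line : ∀ p, S p '' (line f p : Set V) = line f p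
  star_delta_eq_S_delta : ∀ ψ, IsSection f ψ →
    ∀ p X, starForm (d ψ) p X - S p (d ψ p X) ∈ line f p
  star_delta_eq_delta_S : ∀ ψ, IsSection f ψ →
    ∀ p X, starForm (d ψ) p X - d (fun q => S q (ψ q)) p X ∈ line f p
  hopfQ_line : ∀ p X, ∀ v ∈ line f p, hopfQ S p X v = 0

/-- `η ∈ Ω¹(𝓡)`: a smooth 1-form with values in the endomorphisms `B` of `V` that satisfy
`im B ⊂ L ⊂ ker B`. -/
def IsMultiplier (f : M → ℍ[ℝ]) (η : OneForm M EndV) : Prop :=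
  IsSmoothForm η ∧ ∀ p X, IsQuatLinear (η p X) ∧
    (∀ v, η p X v ∈ line f p) ∧ ∀ v ∈ line f p, η p X v = 0

/-- `2*A + η`, with `A` the Hopf field of `S`. -/
def twoStarA (S : M → EndV) (η : OneForm M EndV) : OneForm M EndV :=
  (2 : ℝ) • starForm (hopfA S) + η

/-- `2*Q + η`, with `Q` the Hopf field of `S`. -/
def twoStarQ (S : M → EndV) (η : OneForm M EndV) : OneForm M EndV :=
  (2 : ℝ) • starForm (hopfQ S) + η

/-- Constrained Willmore immersions: the Euler-Lagrange equation `d(2*A + η) = 0` holds for some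
`η ∈ Ω¹(𝓡)`, the Lagrange multiplier, where `A` is the Hopf field of the mean curvature sphere
congruence. -/
def IsConstrainedWillmore (f : M → ℍ[ℝ]) : Prop :=
  IsConformalImmersion f ∧ ∃ S, IsMeanCurvatureSphere f S ∧
    ∃ η, IsMultiplier f η ∧ IsClosedForm (twoStarA S η)

end Surfaces

end QuatSurface

end

open QuatSurface

/-!
Harmonicity of the normals of a conformal immersion `f : M → ℍ`, in terms of its mean curvature
sphere congruence.

Everything is written in the frame `e = (1, 0)`, `ψ = (f, 1)` of the trivial bundle `ℍ²`, where `e`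
spans the line `∞` and `ψ` spans `L`.  The conditions `*δ = Sδ = δS` say that `S e = e N - ψ H` and
`S ψ = -ψ R` for some function `H`; the condition `Q ψ = 0` says `2 H df = dR - R *dR`.  The latter
has exactly one solution `H`, because both sides are multiplied by `-R` from the right under `*`,
and for this solution `H N = R H`, which is `S² = -1`.  So `S` exists and is unique
(`IsMeanCurvatureSphere.isSphereField`, `IsSphereField.isMeanCurvatureSphere`).

From the two expressions `*df = N df = -df R` one finds `dN ∧ df = df ∧ dR`, which turns the
equation of `H` into `2 df H = dN - N *dN` (`IsMeanCurvature.left`).  Therefore, with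
`β = dR + R *dR` and `σ = dN + N *dN`, one has `2 (∇S) ψ = -ψ β` and `2 (∇S) e = e σ` modulo `L`.
Consequently
* `2*A ψ = ½ ψ β` and `2*A e` lies in `L`, so that there is exactly one multiplier `η` for which
  `2*A + η` vanishes on `∞`, and then `2*A + η` is the form `rightForm`, `e ↦ 0`, `ψ ↦ ½ ψ β`;
* `2*Q ψ = 0` and `2*Q e = ½ e σ` modulo `L`, so that there is exactly one multiplier `η` for
  which `2*Q + η` takes values in `∞`, and then `2*Q + η` is the form `leftForm`, `e ↦ ½ e σ`,
  `ψ ↦ 0`.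

By type, `df ∧ β = 0` and `σ ∧ df = 0`, so these two forms are closed iff `β`, respectively `σ`, is
closed.  Since `dn ∧ *dn` is real for a map `n` to the sphere, `dn + n *dn` is closed iff `n` is
harmonic (`isHarmonic_iff_isClosedForm_barForm`).  Finally `2*Q - 2*A = dS` is exact, so a
multiplier for `Q` is also one for `A`, whence the constrained Willmore property in the case of `N`.
-/

noncomputable section

namespace QuatSurface

/-! ### Calculus of forms in the preferred charts -/

section Calculus

variable {M : Type*} [TopologicalSpace M] [ChartedSpace ℂ M]
variable {W : Type*} [NormedAddCommGroup W] [NormedSpace ℝ W]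
variable {W₁ W₂ : Type*} [NormedAddCommGroup W₁] [NormedSpace ℝ W₁]
  [NormedAddCommGroup W₂] [NormedSpace ℝ W₂]

/-- The smooth real surface underlying a Riemann surface. -/
instance isManifold_real [IsManifold 𝓘(ℂ) ω M] : IsManifold 𝓘(ℝ, ℂ) ∞ M := by
  refine isManifold_of_contDiffOn _ _ _ fun e e' he he' => ?_
  have h := (contDiffGroupoid ω 𝓘(ℂ)).compatible he he'
  rw [contDiffGroupoid, mem_groupoid_of_pregroupoid] at h
  exact (ContDiffOn.restrict_scalars ℝ h.1).of_le (by simp)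

lemma _root_.ContMDiff.contDiffOn_chart [IsManifold 𝓘(ℂ) ω M] {F : M → W}
    (hF : ContMDiff 𝓘(ℝ, ℂ) 𝓘(ℝ, W) ∞ F) (p : M) :
    ContDiffOn ℝ ∞ (F ∘ (chartAt ℂ p).symm) (chartAt ℂ p).target :=
  (hF.comp_contMDiffOn (contMDiffOn_chart_symm (I := 𝓘(ℝ, ℂ)) (n := ∞))).contDiffOn

lemma contMDiff_of_contDiffOn_chart [IsManifold 𝓘(ℂ) ω M] {F : M → W}
    (hF : ∀ p, ContDiffOn ℝ ∞ (F ∘ (chartAt ℂ p).symm) (chartAt ℂ p).target) :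
    ContMDiff 𝓘(ℝ, ℂ) 𝓘(ℝ, W) ∞ F := by
  intro p
  have h1 := (hF p).contMDiffOn.comp (contMDiffOn_chart (I := 𝓘(ℝ, ℂ)) (n := ∞) (x := p))
    (fun q hq => (chartAt ℂ p).map_source hq)
  have h2 := h1.congr (f₁ := F) fun q hq => by simp [(chartAt ℂ p).left_inv hq]
  exact h2.contMDiffAt ((chartAt ℂ p).open_source.mem_nhds (mem_chart_source ℂ p))

lemma mdifferentiableAt_chart_symm [IsManifold 𝓘(ℂ) ω M] (p : M) {z : ℂ}
    (hz : z ∈ (chartAt ℂ p).target) :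
    MDifferentiableAt 𝓘(ℝ, ℂ) 𝓘(ℝ, ℂ) (chartAt ℂ p).symm z :=
  ((contMDiffOn_chart_symm (I := 𝓘(ℝ, ℂ)) (n := ∞) (x := p)).contMDiffAt
    ((chartAt ℂ p).open_target.mem_nhds hz)).mdifferentiableAt (by simp)

lemma inChart_d [IsManifold 𝓘(ℂ) ω M] {F : M → W}
    (hF : ContMDiff 𝓘(ℝ, ℂ) 𝓘(ℝ, W) ∞ F) (p : M) {z : ℂ} (hz : z ∈ (chartAt ℂ p).target) :
    inChart p (d F) z = fderiv ℝ (F ∘ (chartAt ℂ p).symm) z := by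
  rw [← mfderiv_eq_fderiv]
  exact (mfderiv_comp z ((hF _).mdifferentiableAt (by simp))
    (mdifferentiableAt_chart_symm p hz)).symm

/-- In the tangent coordinates of `M`, the differential of an inverse chart is the derivative of a
coordinate change. -/
lemma mfderiv_chart_symm [IsManifold 𝓘(ℂ) ω M] (p : M) {z : ℂ}
    (hz : z ∈ (chartAt ℂ p).target) :
    mfderiv 𝓘(ℝ, ℂ) 𝓘(ℝ, ℂ) (chartAt ℂ p).symm z =
      fderiv ℝ (chartAt ℂ ((chartAt ℂ p).symm z) ∘ (chartAt ℂ p).symm) z := by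
  rw [(mdifferentiableAt_chart_symm p hz).mfderiv]
  change fderivWithin ℝ (chartAt ℂ ((chartAt ℂ p).symm z) ∘ (chartAt ℂ p).symm) (Set.range id) z = _
  rw [Set.range_id, fderivWithin_univ]

/-- At its centre, the preferred chart induces the identity of tangent coordinates. -/
lemma inChart_self [IsManifold 𝓘(ℂ) ω M] (α : OneForm M W) (p : M) :
    inChart p α (chartAt ℂ p p) = α p := by
  have h : mfderiv 𝓘(ℝ, ℂ) 𝓘(ℝ, ℂ) (chartAt ℂ p).symm (chartAt ℂ p p) =
      ContinuousLinearMap.id ℝ ℂ := by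
    rw [mfderiv_chart_symm p (mem_chart_target ℂ p),
      (chartAt ℂ p).left_inv (mem_chart_source ℂ p)]
    refine Eq.trans (Filter.EventuallyEq.fderiv_eq ?_) (fderiv_id (x := chartAt ℂ p p))
    filter_upwards [(chartAt ℂ p).open_target.mem_nhds (mem_chart_target ℂ p)] with z hz
    exact (chartAt ℂ p).right_inv hz
  unfold inChart
  rw [h, (chartAt ℂ p).left_inv (mem_chart_source ℂ p)]
  exact ContinuousLinearMap.comp_id _

lemma differentiableAt_coord_change [IsManifold 𝓘(ℂ) ω M] (p q : M) {z : ℂ}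
    (hz : z ∈ (chartAt ℂ p).target) (hq : (chartAt ℂ p).symm z ∈ (chartAt ℂ q).source) :
    DifferentiableAt ℂ (chartAt ℂ q ∘ (chartAt ℂ p).symm) z := by
  have h1 := (contMDiffOn_chart_symm (I := 𝓘(ℂ)) (n := ω) (x := p)).contMDiffAt
    ((chartAt ℂ p).open_target.mem_nhds hz)
  have h2 := (contMDiffOn_chart (I := 𝓘(ℂ)) (n := ω) (x := q)).contMDiffAt
    ((chartAt ℂ q).open_source.mem_nhds hq)
  exact (h2.comp z h1).contDiffAt.differentiableAt (by simp)

/-- The operator `*` does not depend on the chart, as coordinate changes are holomorphic. -/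
lemma inChart_starForm [IsManifold 𝓘(ℂ) ω M] (α : OneForm M W) (p : M) {z : ℂ}
    (hz : z ∈ (chartAt ℂ p).target) :
    inChart p (starForm α) z = (inChart p α z).comp (Complex.I • ContinuousLinearMap.id ℝ ℂ) := by
  have h := (differentiableAt_coord_change p _ hz
    (mem_chart_source ℂ ((chartAt ℂ p).symm z))).fderiv_restrictScalars ℝ
  have h' := (mfderiv_chart_symm p hz).trans h
  ext X
  unfold inChart
  rw [h']
  simp [starForm, mul_assoc]

lemma mfderiv_chart_symm_injective [IsManifold 𝓘(ℂ) ω M] (p : M) {z : ℂ}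
    (hz : z ∈ (chartAt ℂ p).target) :
    Function.Injective (mfderiv 𝓘(ℝ, ℂ) 𝓘(ℝ, ℂ) (chartAt ℂ p).symm z) := by
  have h2 : MDifferentiableAt 𝓘(ℝ, ℂ) 𝓘(ℝ, ℂ) (chartAt ℂ p) ((chartAt ℂ p).symm z) :=
    ((contMDiffOn_chart (I := 𝓘(ℝ, ℂ)) (n := ∞) (x := p)).contMDiffAt
    ((chartAt ℂ p).open_source.mem_nhds ((chartAt ℂ p).map_target hz))).mdifferentiableAt (by simp)
  have h := mfderiv_comp z h2 (mdifferentiableAt_chart_symm p hz)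
  rw [mfderiv_eq_fderiv, Filter.EventuallyEq.fderiv_eq
    (f₁ := (chartAt ℂ p ∘ (chartAt ℂ p).symm)) (f := id)] at h
  · rw [fderiv_id] at h
    intro X Y hXY
    have hX (X : ℂ) : X = mfderiv 𝓘(ℝ, ℂ) 𝓘(ℝ, ℂ) (chartAt ℂ p) ((chartAt ℂ p).symm z)
        (mfderiv 𝓘(ℝ, ℂ) 𝓘(ℝ, ℂ) (chartAt ℂ p).symm z X) := DFunLike.congr_fun h X
    rw [hX X, hX Y, hXY]
  · filter_upwards [(chartAt ℂ p).open_target.mem_nhds hz] with w hw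
    exact (chartAt ℂ p).right_inv hw

/-- The product of a `W`-valued function and a `W₁`-valued 1-form with respect to a
bilinear pairing `B`. -/
def mulForm (B : W →L[ℝ] W₁ →L[ℝ] W₂) (g : M → W) (α : OneForm M W₁) : OneForm M W₂ :=
  fun p => (B (g p)).comp (α p)

/-- The image of a vector valued 1-form under a linear map of the values. -/
def mapForm (T : W →L[ℝ] W₁) (α : OneForm M W) : OneForm M W₁ := fun p => T.comp (α p)

lemma d_eq_fderiv [IsManifold 𝓘(ℂ) ω M] {F : M → W}
    (hF : ContMDiff 𝓘(ℝ, ℂ) 𝓘(ℝ, W) ∞ F) (p : M) :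
    d F p = fderiv ℝ (F ∘ (chartAt ℂ p).symm) (chartAt ℂ p p) := by
  rw [← inChart_d hF p (mem_chart_target ℂ p), inChart_self]

lemma _root_.ContMDiff.differentiableAt_chart [IsManifold 𝓘(ℂ) ω M] {F : M → W}
    (hF : ContMDiff 𝓘(ℝ, ℂ) 𝓘(ℝ, W) ∞ F) (p : M) :
    DifferentiableAt ℝ (F ∘ (chartAt ℂ p).symm) (chartAt ℂ p p) :=
  ((hF.contDiffOn_chart p).contDiffAt
    ((chartAt ℂ p).open_target.mem_nhds (mem_chart_target ℂ p))).differentiableAt (by simp)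

lemma IsSmoothForm.differentiableAt {α : OneForm M W}
    (hα : IsSmoothForm α) (p : M) : DifferentiableAt ℝ (inChart p α) (chartAt ℂ p p) :=
  ((hα p).contDiffAt
    ((chartAt ℂ p).open_target.mem_nhds (mem_chart_target ℂ p))).differentiableAt (by simp)

lemma isSmoothForm_d [IsManifold 𝓘(ℂ) ω M] {F : M → W}
    (hF : ContMDiff 𝓘(ℝ, ℂ) 𝓘(ℝ, W) ∞ F) : IsSmoothForm (d F) := fun p =>
  ((hF.contDiffOn_chart p).fderiv_of_isOpen (chartAt ℂ p).open_target (m := ∞) (by simp)).congr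
    fun _ hz => inChart_d hF p hz

lemma IsSmoothForm.starForm [IsManifold 𝓘(ℂ) ω M] {α : OneForm M W} (hα : IsSmoothForm α) :
    IsSmoothForm (starForm α) := fun p =>
  ((hα p).clm_comp contDiffOn_const).congr fun _ hz => inChart_starForm α p hz

lemma IsSmoothForm.add {α β : OneForm M W} (hα : IsSmoothForm α) (hβ : IsSmoothForm β) :
    IsSmoothForm (α + β) := fun p =>
  ((hα p).add (hβ p)).congr fun _ _ => ContinuousLinearMap.add_comp _ _ _

lemma IsSmoothForm.smul {α : OneForm M W} (hα : IsSmoothForm α) (c : ℝ) :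
    IsSmoothForm (c • α) := fun p =>
  ((hα p).const_smul c).congr fun _ _ => ContinuousLinearMap.smul_comp _ _ _

lemma IsSmoothForm.sub {α β : OneForm M W} (hα : IsSmoothForm α) (hβ : IsSmoothForm β) :
    IsSmoothForm (α - β) := fun p =>
  ((hα p).sub (hβ p)).congr fun _ _ => ContinuousLinearMap.sub_comp _ _ _

lemma isSmoothForm_zero : IsSmoothForm (0 : OneForm M W) := fun _ =>
  (contDiffOn_const (c := (0 : ℂ →L[ℝ] W))).congr fun _ _ => ContinuousLinearMap.zero_comp _

lemma IsSmoothForm.mapForm {α : OneForm M W} (hα : IsSmoothForm α) (T : W →L[ℝ] W₁) :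
    IsSmoothForm (mapForm T α) := fun p =>
  (contDiffOn_const (c := T)).clm_comp (hα p)

lemma IsSmoothForm.mulForm [IsManifold 𝓘(ℂ) ω M] {α : OneForm M W₁} (hα : IsSmoothForm α)
    {g : M → W} (hg : ContMDiff 𝓘(ℝ, ℂ) 𝓘(ℝ, W) ∞ g) (B : W →L[ℝ] W₁ →L[ℝ] W₂) :
    IsSmoothForm (mulForm B g α) := fun p =>
  (B.contDiff.comp_contDiffOn (hg.contDiffOn_chart p)).clm_comp (hα p)

/-- A function that is a smooth expression `G` in the values of two smooth 1-forms on a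
nonzero tangent vector, and independent of that vector, is smooth. -/
lemma contMDiff_of_eq_on_tangent [IsManifold 𝓘(ℂ) ω M] {α β : OneForm M W} {g : M → W₁}
    (hα : IsSmoothForm α) (hβ : IsSmoothForm β) {G : W × W → W₁}
    (hG : ContDiffOn ℝ ∞ G {x | x.1 ≠ 0}) (h0 : ∀ p X, X ≠ 0 → α p X ≠ 0)
    (hg : ∀ p X, X ≠ 0 → g p = G (α p X, β p X)) : ContMDiff 𝓘(ℝ, ℂ) 𝓘(ℝ, W₁) ∞ g := by
  refine contMDiff_of_contDiffOn_chart fun p => ?_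
  have hne : ∀ z ∈ (chartAt ℂ p).target,
      mfderiv 𝓘(ℝ, ℂ) 𝓘(ℝ, ℂ) (chartAt ℂ p).symm z (1 : ℂ) ≠ (0 : ℂ) := fun z hz h => by
    have := mfderiv_chart_symm_injective p hz (h.trans (ContinuousLinearMap.map_zero _).symm)
    exact one_ne_zero (α := ℂ) this
  have h1 : ContDiffOn ℝ ∞ (fun z => (inChart p α z 1, inChart p β z 1)) (chartAt ℂ p).target :=
    ((hα p).clm_apply contDiffOn_const).prodMk ((hβ p).clm_apply contDiffOn_const)
  exact (hG.comp h1 fun z hz => h0 _ _ (hne z hz)).congr fun z hz => hg _ _ (hne z hz)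

lemma extD_add {α β : OneForm M W} (hα : IsSmoothForm α) (hβ : IsSmoothForm β) (p : M)
    (X Y : ℂ) : extD (α + β) p X Y = extD α p X Y + extD β p X Y := by
  have h : inChart p (α + β) = inChart p α + inChart p β := by
    funext z; exact ContinuousLinearMap.add_comp _ _ _
  simp only [extD, h, fderiv_add (hα.differentiableAt p) (hβ.differentiableAt p),
    add_apply]
  abel

/-- `d ∘ d = 0`. -/
lemma extD_d [IsManifold 𝓘(ℂ) ω M] {F : M → W}
    (hF : ContMDiff 𝓘(ℝ, ℂ) 𝓘(ℝ, W) ∞ F) (p : M) (X Y : ℂ) : extD (d F) p X Y = 0 := by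
  have hm := (chartAt ℂ p).open_target.mem_nhds (mem_chart_target ℂ p)
  have h : inChart p (d F) =ᶠ[nhds (chartAt ℂ p p)] fderiv ℝ (F ∘ (chartAt ℂ p).symm) := by
    filter_upwards [hm] with z hz using inChart_d hF p hz
  have hs := ((hF.contDiffOn_chart p).contDiffAt hm).isSymmSndFDerivAt
    (by simp [ENat.LEInfty.out])
  rw [extD, h.fderiv_eq, hs.eq X Y, sub_self]

lemma extD_mapForm {α : OneForm M W} (hα : IsSmoothForm α) (T : W →L[ℝ] W₁) (p : M)
    (X Y : ℂ) : extD (mapForm T α) p X Y = T (extD α p X Y) := by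
  have h : fderiv ℝ (inChart p (mapForm T α)) (chartAt ℂ p p) =
      (ContinuousLinearMap.compL ℝ ℂ W W₁ T).comp (fderiv ℝ (inChart p α) (chartAt ℂ p p)) :=
    ((ContinuousLinearMap.compL ℝ ℂ W W₁ T).hasFDerivAt.comp _
      (hα.differentiableAt p).hasFDerivAt).fderiv
  simp [extD, h]

lemma extD_smul {α : OneForm M W} (hα : IsSmoothForm α) (c : ℝ) (p : M) (X Y : ℂ) :
    extD (c • α) p X Y = c • extD α p X Y :=
  extD_mapForm hα (c • ContinuousLinearMap.id ℝ W) p X Y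

/-- The Leibniz rule `d(g α) = dg ∧ α + g dα`. -/
lemma extD_mulForm [IsManifold 𝓘(ℂ) ω M] {α : OneForm M W₁} (hα : IsSmoothForm α)
    {g : M → W} (hg : ContMDiff 𝓘(ℝ, ℂ) 𝓘(ℝ, W) ∞ g) (B : W →L[ℝ] W₁ →L[ℝ] W₂) (p : M)
    (X Y : ℂ) : extD (mulForm B g α) p X Y =
      B (d g p X) (α p Y) - B (d g p Y) (α p X) + B (g p) (extD α p X Y) := by
  have h : fderiv ℝ (inChart p (mulForm B g α)) (chartAt ℂ p p) = _ :=
    ((B.hasFDerivAt.comp _ (hg.differentiableAt_chart p).hasFDerivAt).clm_comp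
      (hα.differentiableAt p).hasFDerivAt).fderiv
  rw [← d_eq_fderiv hg, inChart_self] at h
  simp only [extD, h]
  simp [(chartAt ℂ p).left_inv (mem_chart_source ℂ p)]
  abel

lemma _root_.ContMDiff.bilin [IsManifold 𝓘(ℂ) ω M] {F : M → W} {G : M → W₁}
    (hF : ContMDiff 𝓘(ℝ, ℂ) 𝓘(ℝ, W) ∞ F) (hG : ContMDiff 𝓘(ℝ, ℂ) 𝓘(ℝ, W₁) ∞ G)
    (B : W →L[ℝ] W₁ →L[ℝ] W₂) : ContMDiff 𝓘(ℝ, ℂ) 𝓘(ℝ, W₂) ∞ (fun q => B (F q) (G q)) :=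
  contMDiff_of_contDiffOn_chart fun p => (B.contDiff.comp_contDiffOn
    (hF.contDiffOn_chart p)).clm_apply (hG.contDiffOn_chart p)

lemma _root_.ContMDiff.clm_map [IsManifold 𝓘(ℂ) ω M] {F : M → W}
    (hF : ContMDiff 𝓘(ℝ, ℂ) 𝓘(ℝ, W) ∞ F) (T : W →L[ℝ] W₁) :
    ContMDiff 𝓘(ℝ, ℂ) 𝓘(ℝ, W₁) ∞ (fun q => T (F q)) :=
  contMDiff_of_contDiffOn_chart fun p => T.contDiff.comp_contDiffOn (hF.contDiffOn_chart p)

lemma d_bilin [IsManifold 𝓘(ℂ) ω M] {F : M → W} {G : M → W₁}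
    (hF : ContMDiff 𝓘(ℝ, ℂ) 𝓘(ℝ, W) ∞ F) (hG : ContMDiff 𝓘(ℝ, ℂ) 𝓘(ℝ, W₁) ∞ G)
    (B : W →L[ℝ] W₁ →L[ℝ] W₂) (p : M) (X : ℂ) :
    d (fun q => B (F q) (G q)) p X = B (d F p X) (G p) + B (F p) (d G p X) := by
  have h : fderiv ℝ ((fun q => B (F q) (G q)) ∘ (chartAt ℂ p).symm) (chartAt ℂ p p) = _ :=
    ((B.hasFDerivAt.comp _ (hF.differentiableAt_chart p).hasFDerivAt).clm_apply
      (hG.differentiableAt_chart p).hasFDerivAt).fderiv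
  rw [d_eq_fderiv (hF.bilin hG B), h, d_eq_fderiv hF, d_eq_fderiv hG]
  simp [(chartAt ℂ p).left_inv (mem_chart_source ℂ p)]
  abel

lemma d_clm [IsManifold 𝓘(ℂ) ω M] {F : M → W}
    (hF : ContMDiff 𝓘(ℝ, ℂ) 𝓘(ℝ, W) ∞ F) (T : W →L[ℝ] W₁) (p : M) (X : ℂ) :
    d (fun q => T (F q)) p X = T (d F p X) := by
  have h : fderiv ℝ ((fun q => T (F q)) ∘ (chartAt ℂ p).symm) (chartAt ℂ p p) = _ :=
    (T.hasFDerivAt.comp _ (hF.differentiableAt_chart p).hasFDerivAt).fderiv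
  rw [d_eq_fderiv (hF.clm_map T), h, d_eq_fderiv hF]
  rfl

lemma d_const (w : W) (p : M) (X : ℂ) : d (fun _ : M => w) p X = 0 := by
  rw [d, mfderiv_const]; rfl

lemma d_add [IsManifold 𝓘(ℂ) ω M] {F G : M → W}
    (hF : ContMDiff 𝓘(ℝ, ℂ) 𝓘(ℝ, W) ∞ F) (hG : ContMDiff 𝓘(ℝ, ℂ) 𝓘(ℝ, W) ∞ G) (p : M) (X : ℂ) :
    d (fun q => F q + G q) p X = d F p X + d G p X := by
  rw [d_eq_fderiv hF, d_eq_fderiv hG,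
    d_eq_fderiv (F := fun q => F q + G q) (hF.add hG)]
  have := fderiv_add (hF.differentiableAt_chart p) (hG.differentiableAt_chart p)
  exact DFunLike.congr_fun this X

end Calculus

/-! ### Forms with quaternionic values -/

section Algebra

variable {M : Type*} [TopologicalSpace M] [ChartedSpace ℂ M]
variable {W : Type*} [NormedAddCommGroup W] [NormedSpace ℝ W]

lemma starForm_apply {M W : Type*} [NormedAddCommGroup W] [NormedSpace ℝ W] (α : OneForm M W)
    (p : M) (X : ℂ) : starForm α p X = α p (Complex.I * X) := rfl

lemma I_mul_I_mul (X : ℂ) : Complex.I * (Complex.I * X) = -X := by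
  rw [← mul_assoc, Complex.I_mul_I, neg_one_mul]

lemma clm_apply_eq_re_im (T : ℂ →L[ℝ] W) (X : ℂ) : T X = X.re • T 1 + X.im • T Complex.I := by
  rw [← map_smul, ← map_smul, ← map_add]
  congr 1
  apply Complex.ext <;> simp

/-- A 2-form on a surface is determined by its value on `(1, i)`. -/
lemma extD_eq_det (α : OneForm M W) (p : M) (X Y : ℂ) :
    extD α p X Y = (X.re * Y.im - X.im * Y.re) • extD α p 1 Complex.I := by
  unfold extD
  generalize fderiv ℝ (inChart p α) (chartAt ℂ p p) = T
  have h (X Y : ℂ) : T X Y = X.re • (Y.re • T 1 1 + Y.im • T 1 Complex.I) +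
      X.im • (Y.re • T Complex.I 1 + Y.im • T Complex.I Complex.I) := by
    rw [clm_apply_eq_re_im T X, add_apply, smul_apply, smul_apply, clm_apply_eq_re_im (T 1) Y,
      clm_apply_eq_re_im (T Complex.I) Y]
  rw [h X Y, h Y X]
  module

lemma isClosedForm_iff (α : OneForm M W) :
    IsClosedForm α ↔ ∀ p, extD α p 1 Complex.I = 0 :=
  ⟨fun h p => h p _ _, fun h p X Y => by rw [extD_eq_det, h, smul_zero]⟩

lemma mul_self_of_mem_imSphere {a : ℍ[ℝ]} (ha : a ∈ imSphere) : a * a = -1 := by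
  have h : star a = -a := Quaternion.star_eq_neg.2 ha.1
  have h2 := Quaternion.self_mul_star a
  rw [h, Quaternion.normSq_eq_norm_mul_self, ha.2] at h2
  rw [← neg_neg (a * a), ← mul_neg, h2]
  simp

/-- Quaternionic multiplication as a real bilinear map. -/
abbrev mulL : ℍ[ℝ] →L[ℝ] ℍ[ℝ] →L[ℝ] ℍ[ℝ] := ContinuousLinearMap.mul ℝ ℍ[ℝ]

end Algebra

/-! ### Maps to the 2-sphere -/

section Sphere

variable {M : Type*} [TopologicalSpace M] [ChartedSpace ℂ M]
variable {n : M → ℍ[ℝ]}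

/-- The 1-form `dn + n *dn`, twice the part of `dn` on which `*` is left multiplication by `-n`. -/
def barForm (n : M → ℍ[ℝ]) : OneForm M ℍ[ℝ] := d n + mulForm mulL n (starForm (d n))

lemma barForm_apply (p : M) (X : ℂ) :
    barForm n p X = d n p X + n p * d n p (Complex.I * X) := rfl

/-- `*(dn + n *dn) = -n (dn + n *dn)`. -/
lemma barForm_I_mul (hn : ∀ p, n p ∈ imSphere) (p : M) (X : ℂ) :
    barForm n p (Complex.I * X) = -(n p * barForm n p X) := by
  have h := mul_self_of_mem_imSphere (hn p)
  rw [barForm_apply, barForm_apply, I_mul_I_mul, map_neg, mul_add, ← mul_assoc, h]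
  noncomm_ring

variable [IsManifold 𝓘(ℂ) ω M]

lemma mul_d_of_mem_imSphere (hn : ∀ p, n p ∈ imSphere)
    (hs : ContMDiff 𝓘(ℝ, ℂ) 𝓘(ℝ, ℍ[ℝ]) ∞ n) (p : M) (X : ℂ) :
    n p * d n p X = -(d n p X * n p) := by
  have h := d_bilin hs hs mulL p X
  have h2 : (fun q => mulL (n q) (n q)) = fun _ => -1 := by
    funext q; exact mul_self_of_mem_imSphere (hn q)
  rw [h2, d_const] at h
  exact (neg_eq_of_add_eq_zero_right h.symm).symm

lemma isSmoothForm_barForm (hs : ContMDiff 𝓘(ℝ, ℂ) 𝓘(ℝ, ℍ[ℝ]) ∞ n) :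
    IsSmoothForm (barForm n) :=
  (isSmoothForm_d hs).add ((isSmoothForm_d hs).starForm.mulForm hs _)

/-- The form anticommutes with `n`, as `dn` does. -/
lemma mul_barForm (hn : ∀ p, n p ∈ imSphere)
    (hs : ContMDiff 𝓘(ℝ, ℂ) 𝓘(ℝ, ℍ[ℝ]) ∞ n) (p : M) (X : ℂ) :
    n p * barForm n p X = -(barForm n p X * n p) := by
  have h1 := mul_d_of_mem_imSphere hn hs p X
  have h2 := mul_d_of_mem_imSphere hn hs p (Complex.I * X)
  rw [barForm_apply, mul_add, add_mul, mul_assoc (n p) _ (n p), h1, h2]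
  noncomm_ring

lemma re_d_of_mem_imSphere (hn : ∀ p, n p ∈ imSphere)
    (hs : ContMDiff 𝓘(ℝ, ℂ) 𝓘(ℝ, ℍ[ℝ]) ∞ n) (p : M) (X : ℂ) : (d n p X).re = 0 := by
  have hre (a : ℍ[ℝ]) : innerSL ℝ (1 : ℍ[ℝ]) a = a.re := by
    rw [innerSL_apply_apply, Quaternion.inner_def, one_mul, Quaternion.re_star]
  have h : (fun q => innerSL ℝ (1 : ℍ[ℝ]) (n q)) = fun _ => 0 :=
    funext fun q => (hre _).trans (hn q).1
  have h2 := d_clm hs (innerSL ℝ (1 : ℍ[ℝ])) p X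
  rw [h, d_const, hre] at h2
  exact h2.symm

lemma d_mul_d (hn : ∀ p, n p ∈ imSphere)
    (hs : ContMDiff 𝓘(ℝ, ℂ) 𝓘(ℝ, ℍ[ℝ]) ∞ n) (p : M) (X : ℂ) :
    d n p X * d n p X = -((‖d n p X‖ ^ 2 : ℝ) : ℍ[ℝ]) := by
  have h : star (d n p X) = -d n p X :=
    Quaternion.star_eq_neg.2 (re_d_of_mem_imSphere hn hs p X)
  have h2 := Quaternion.self_mul_star (d n p X)
  rw [h, Quaternion.normSq_eq_norm_mul_self, ← pow_two] at h2
  rw [← h2, mul_neg, neg_neg]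

/-- `d(dn + n *dn) = dn ∧ *dn + n d*dn` on `(1, i)`, where `dn ∧ *dn` is `|dn|²` because `dn` is
imaginary. -/
lemma extD_barForm (hn : ∀ p, n p ∈ imSphere)
    (hs : ContMDiff 𝓘(ℝ, ℂ) 𝓘(ℝ, ℍ[ℝ]) ∞ n) (p : M) :
    extD (barForm n) p 1 Complex.I = n p * extD (starForm (d n)) p 1 Complex.I +
      ((‖d n p 1‖ ^ 2 + ‖d n p Complex.I‖ ^ 2 : ℝ) : ℍ[ℝ]) := by
  rw [barForm, extD_add (isSmoothForm_d hs) ((isSmoothForm_d hs).starForm.mulForm hs _),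
    extD_d hs, extD_mulForm (isSmoothForm_d hs).starForm hs]
  simp only [starForm_apply, ContinuousLinearMap.mul_apply', mul_one, Complex.I_mul_I, map_neg,
    d_mul_d hn hs, Quaternion.coe_add]
  abel

/-- The same exterior derivative, computed from the expression `dn - (*dn) n` of the form. -/
lemma extD_barForm_right (hn : ∀ p, n p ∈ imSphere)
    (hs : ContMDiff 𝓘(ℝ, ℂ) 𝓘(ℝ, ℍ[ℝ]) ∞ n) (p : M) :
    extD (barForm n) p 1 Complex.I = -(extD (starForm (d n)) p 1 Complex.I * n p +
      ((‖d n p 1‖ ^ 2 + ‖d n p Complex.I‖ ^ 2 : ℝ) : ℍ[ℝ])) := by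
  have h : barForm n = d n + (-1 : ℝ) • mulForm mulL.flip n (starForm (d n)) := by
    funext p
    ext1 X
    have h1 := mul_d_of_mem_imSphere hn hs p (Complex.I * X)
    change d n p X + n p * d n p (Complex.I * X) =
      d n p X + (-1 : ℝ) • (d n p (Complex.I * X) * n p)
    rw [h1, neg_one_smul]
  have hs' := (isSmoothForm_d hs).starForm.mulForm hs mulL.flip
  rw [h, extD_add (isSmoothForm_d hs) (hs'.smul _),
    extD_d hs, extD_smul hs', extD_mulForm (isSmoothForm_d hs).starForm hs]
  simp only [starForm_apply, ContinuousLinearMap.flip_apply, ContinuousLinearMap.mul_apply',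
    mul_one, Complex.I_mul_I, map_neg, d_mul_d hn hs, Quaternion.coe_add]
  rw [neg_one_smul]
  abel

/-- A map `n` to the sphere is harmonic iff `n *dn` is closed: as `dn ∧ *dn` is real, `d(n *dn) = 0`
says that `d*dn` is a real multiple of `n`, and the factor is determined by `n² = -1`. -/
lemma isHarmonic_iff_isClosedForm_barForm (hn : ∀ p, n p ∈ imSphere)
    (hs : ContMDiff 𝓘(ℝ, ℂ) 𝓘(ℝ, ℍ[ℝ]) ∞ n) :
    IsHarmonic n ↔ IsClosedForm (barForm n) := by
  rw [isClosedForm_iff]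
  constructor
  · rintro ⟨-, -, h⟩ p
    obtain ⟨r, hr⟩ := h p 1 Complex.I
    have h1 := extD_barForm hn hs p
    have h2 := extD_barForm_right hn hs p
    rw [hr, mul_smul_comm, mul_self_of_mem_imSphere (hn p)] at h1
    rw [hr, smul_mul_assoc, mul_self_of_mem_imSphere (hn p)] at h2
    -- the two expressions for `d(dn + n *dn)` are opposite to each other when `d*dn` is normal
    have h3 : (2 : ℝ) • extD (barForm n) p 1 Complex.I = 0 := by
      rw [two_smul]
      nth_rewrite 1 [h1]
      rw [h2]
      abel
    exact (smul_eq_zero.1 h3).resolve_left two_ne_zero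
  · intro h
    refine ⟨hn, hs, fun p X Y => ?_⟩
    have h1 := extD_barForm hn hs p
    rw [h p] at h1
    have h2 := congrArg (n p * ·) h1
    simp only [mul_zero, mul_add, ← mul_assoc, mul_self_of_mem_imSphere (hn p)] at h2
    rw [← Quaternion.coe_commutes, Quaternion.coe_mul_eq_smul, neg_one_mul] at h2
    rw [extD_eq_det, neg_add_eq_zero.1 h2.symm, smul_smul]
    exact ⟨_, rfl⟩

end Sphere

/-! ### Normals and mean curvature of a conformal immersion -/

section Surface

variable {M : Type*} [TopologicalSpace M] [ChartedSpace ℂ M]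
variable {f N R H : M → ℍ[ℝ]}

lemma IsConformalImmersion.d_ne_zero (hf : IsConformalImmersion f) (p : M) {X : ℂ} (hX : X ≠ 0) :
    d f p X ≠ 0 := fun h => hX ((hf.2 p).injective (h.trans (map_zero _).symm))

/-- For a conformal linear map `T : ℂ → ℍ`, the quotient `T(i) T(1)⁻¹` is a unit
imaginary quaternion. -/
lemma mul_inv_mem_imSphere {T : ℂ →L[ℝ] ℍ[ℝ]} (hT : IsConformalMap T) :
    T Complex.I * (T 1)⁻¹ ∈ imSphere := by
  have h0 : T 1 ≠ 0 := fun h => one_ne_zero (hT.injective (h.trans (map_zero T).symm))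
  obtain ⟨c, hc, h⟩ := (isConformalMap_iff T).1 hT
  have h1 := h Complex.I 1
  have h2 := h Complex.I Complex.I
  have h3 := h 1 1
  rw [real_inner_self_eq_norm_sq] at h2 h3
  constructor
  · rw [Quaternion.inner_def] at h1
    simp only [Quaternion.inv_def, mul_smul_comm, Quaternion.re_smul, h1]
    simp
  · rw [norm_mul, norm_inv, mul_inv_eq_one₀ (norm_ne_zero_iff.2 h0)]
    rw [← sq_eq_sq₀ (norm_nonneg _) (norm_nonneg _), h2, h3]
    simp

/-- The same for `-T(1)⁻¹ T(i)`. -/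
lemma neg_inv_mul_mem_imSphere {T : ℂ →L[ℝ] ℍ[ℝ]} (hT : IsConformalMap T) :
    -((T 1)⁻¹ * T Complex.I) ∈ imSphere := by
  have h := mul_inv_mem_imSphere hT
  constructor
  · rw [Quaternion.re_neg, show ((T 1)⁻¹ * T Complex.I).re = (T Complex.I * (T 1)⁻¹).re by
      rw [Quaternion.re_mul, Quaternion.re_mul]; ring, h.1, neg_zero]
  · rw [norm_neg, norm_mul, mul_comm, ← norm_mul, h.2]

lemma contDiffOn_inv_quaternion : ContDiffOn ℝ ∞ (fun a : ℍ[ℝ] => a⁻¹) {a | a ≠ 0} :=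
  fun a ha => by
    have h := contDiffAt_ringInverse ℝ (n := ∞) (Units.mk0 a ha)
    rw [Ring.inverse_eq_inv'] at h
    exact h.contDiffWithinAt

lemma existsUnique_isLeftNormal (hf : IsConformalImmersion f) : ∃! N, IsLeftNormal f N := by
  have h0 (p : M) : d f p 1 ≠ 0 := hf.d_ne_zero p one_ne_zero
  refine ⟨fun p => d f p Complex.I * (d f p 1)⁻¹, ⟨fun p => mul_inv_mem_imSphere (hf.2 p), ?_⟩, ?_⟩
  · intro p X
    have h := mul_self_of_mem_imSphere (mul_inv_mem_imSphere (hf.2 p))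
    have h1 : d f p Complex.I * (d f p 1)⁻¹ * d f p 1 = d f p Complex.I := by
      rw [mul_assoc, inv_mul_cancel₀ (h0 p), mul_one]
    rw [clm_apply_eq_re_im (starForm (d f) p), clm_apply_eq_re_im (d f p) X, mul_add,
      mul_smul_comm, mul_smul_comm, starForm_apply, starForm_apply, mul_one, h1,
      Complex.I_mul_I, map_neg]
    congr 2
    calc -d f p 1 = -1 * d f p 1 := (neg_one_mul _).symm
      _ = _ := by rw [← h, mul_assoc, h1]
  · intro N hN
    funext p
    have := hN.2 p 1
    rw [starForm_apply, mul_one] at this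
    rw [this, mul_assoc, mul_inv_cancel₀ (h0 p), mul_one]

lemma existsUnique_isRightNormal (hf : IsConformalImmersion f) : ∃! R, IsRightNormal f R := by
  have h0 (p : M) : d f p 1 ≠ 0 := hf.d_ne_zero p one_ne_zero
  refine ⟨fun p => -((d f p 1)⁻¹ * d f p Complex.I),
    ⟨fun p => neg_inv_mul_mem_imSphere (hf.2 p), ?_⟩, ?_⟩
  · intro p X
    have h := mul_self_of_mem_imSphere (neg_inv_mul_mem_imSphere (hf.2 p))
    have h1 : d f p 1 * -((d f p 1)⁻¹ * d f p Complex.I) = -d f p Complex.I := by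
      rw [mul_neg, ← mul_assoc, mul_inv_cancel₀ (h0 p), one_mul]
    have h2 : d f p Complex.I * -((d f p 1)⁻¹ * d f p Complex.I) = d f p 1 := by
      calc _ = -(d f p 1 * -((d f p 1)⁻¹ * d f p Complex.I)) *
            -((d f p 1)⁻¹ * d f p Complex.I) := by rw [h1, neg_neg]
        _ = d f p 1 := by rw [neg_mul, mul_assoc, h]; simp
    rw [clm_apply_eq_re_im (starForm (d f) p), clm_apply_eq_re_im (d f p) X, add_mul,
      smul_mul_assoc, smul_mul_assoc, starForm_apply, starForm_apply, mul_one, h1, h2,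
      Complex.I_mul_I, map_neg]
    module
  · intro R hR
    funext p
    have := hR.2 p 1
    rw [starForm_apply, mul_one] at this
    rw [this, mul_neg, ← mul_assoc, inv_mul_cancel₀ (h0 p), one_mul, neg_neg]

/-- `H` is the quaternion valued mean curvature of `f`, with respect to the right normal `R`:
`2 H df = dR - R *dR`. -/
def IsMeanCurvature (f R H : M → ℍ[ℝ]) : Prop :=
  ∀ p X, 2 * (H p * d f p X) = d R p X - R p * d R p (Complex.I * X)

lemma mul_d_eq_neg_d_mul (hN : IsLeftNormal f N) (hR : IsRightNormal f R) (p : M) (X : ℂ) :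
    N p * d f p X = -(d f p X * R p) := (hN.2 p X).symm.trans (hR.2 p X)

lemma IsMeanCurvature.unique {H' : M → ℍ[ℝ]} (hH : IsMeanCurvature f R H)
    (hf : IsConformalImmersion f) (hH' : IsMeanCurvature f R H') : H = H' := by
  funext p
  have h := (hH p 1).trans (hH' p 1).symm
  rw [two_mul, two_mul, ← two_smul ℝ, ← two_smul ℝ] at h
  exact mul_right_cancel₀ (hf.d_ne_zero p one_ne_zero)
    (smul_right_injective _ (two_ne_zero (α := ℝ)) h)

/-- `H N = R H`, since both sides multiply `df` to `H *df`. -/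
lemma IsMeanCurvature.mul_left_normal (hH : IsMeanCurvature f R H) (hf : IsConformalImmersion f)
    (hN : IsLeftNormal f N) (hR : IsRightNormal f R) (p : M) : H p * N p = R p * H p := by
  have h0 := hf.d_ne_zero p one_ne_zero
  have h1 := hH p 1
  have h2 := hH p (Complex.I * 1)
  have h3 := hN.2 p 1
  have h4 := mul_self_of_mem_imSphere (hR.1 p)
  rw [starForm_apply] at h3
  rw [h3, I_mul_I_mul, map_neg] at h2
  apply mul_right_cancel₀ h0
  have : (2 : ℝ) • (H p * N p * d f p 1) = (2 : ℝ) • (R p * H p * d f p 1) := by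
    linear_combination (norm := skip) h2 - R p * h1 + h4 * d R p (Complex.I * 1)
    simp only [two_smul, two_mul, mul_add, mul_sub, mul_assoc, neg_mul, mul_neg, one_mul]
    abel
  exact smul_right_injective _ (two_ne_zero (α := ℝ)) this

variable [IsManifold 𝓘(ℂ) ω M]

lemma IsLeftNormal.contMDiff (hN : IsLeftNormal f N) (hf : IsConformalImmersion f) :
    ContMDiff 𝓘(ℝ, ℂ) 𝓘(ℝ, ℍ[ℝ]) ∞ N := by
  refine contMDiff_of_eq_on_tangent (G := fun x => x.2 * x.1⁻¹) (isSmoothForm_d hf.1)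
    (isSmoothForm_d hf.1).starForm
    (contDiffOn_snd.mul (contDiffOn_inv_quaternion.comp contDiffOn_fst fun _ hx => hx))
    (fun p X hX => hf.d_ne_zero p hX) ?_
  intro p X hX
  simp only [hN.2 p X, mul_assoc, mul_inv_cancel₀ (hf.d_ne_zero p hX), mul_one]

lemma IsRightNormal.contMDiff (hR : IsRightNormal f R) (hf : IsConformalImmersion f) :
    ContMDiff 𝓘(ℝ, ℂ) 𝓘(ℝ, ℍ[ℝ]) ∞ R := by
  refine contMDiff_of_eq_on_tangent (G := fun x => -(x.1⁻¹ * x.2)) (isSmoothForm_d hf.1)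
    (isSmoothForm_d hf.1).starForm
    ((contDiffOn_inv_quaternion.comp contDiffOn_fst fun _ hx => hx).mul contDiffOn_snd).neg
    (fun p X hX => hf.d_ne_zero p hX) ?_
  intro p X hX
  simp only [hR.2 p X, mul_neg, ← mul_assoc, inv_mul_cancel₀ (hf.d_ne_zero p hX), one_mul, neg_neg]


lemma exists_isMeanCurvature (hf : IsConformalImmersion f) (hR : IsRightNormal f R) :
    ∃ H, ContMDiff 𝓘(ℝ, ℂ) 𝓘(ℝ, ℍ[ℝ]) ∞ H ∧ IsMeanCurvature f R H := by
  have hRs := hR.contMDiff hf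
  have h0 (p : M) : d f p 1 ≠ 0 := hf.d_ne_zero p one_ne_zero
  let β : OneForm M ℍ[ℝ] := d R - mulForm mulL R (starForm (d R))
  have hβs : IsSmoothForm β :=
    (isSmoothForm_d hRs).sub ((isSmoothForm_d hRs).starForm.mulForm hRs mulL)
  have hβ (p : M) (X : ℂ) : β p X = d R p X - R p * d R p (Complex.I * X) := rfl
  -- `df` and `dR - R *dR` are both multiplied by `-R` from the right under `*`
  have hmain (p : M) (Y : ℂ) : β p 1 * (d f p 1)⁻¹ * d f p Y = β p Y := by
    have h1 : β p 1 * (d f p 1)⁻¹ * d f p 1 = β p 1 := by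
      rw [mul_assoc, inv_mul_cancel₀ (h0 p), mul_one]
    have h2 : β p 1 * (d f p 1)⁻¹ * d f p Complex.I = β p Complex.I := by
      have h3 := hR.2 p 1
      have h4 := mul_d_of_mem_imSphere hR.1 hRs p 1
      have h5 := mul_d_of_mem_imSphere hR.1 hRs p Complex.I
      have h6 := mul_self_of_mem_imSphere (hR.1 p)
      rw [starForm_apply, mul_one] at h3
      rw [h3, mul_neg, ← mul_assoc, h1, hβ, hβ, mul_one, Complex.I_mul_I, map_neg]
      linear_combination (norm := skip) -h4 + R p * h5 - h6 * d R p Complex.I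
      simp only [sub_mul, mul_assoc, neg_mul, mul_neg, one_mul]
      abel
    rw [clm_apply_eq_re_im (d f p) Y, clm_apply_eq_re_im (β p) Y, mul_add, mul_smul_comm,
      mul_smul_comm, h1, h2]
  let H : M → ℍ[ℝ] := fun p => (1 / 2 : ℝ) • (β p 1 * (d f p 1)⁻¹)
  have hH (p : M) (X : ℂ) : H p * d f p X = (1 / 2 : ℝ) • β p X := by
    rw [← hmain p X, smul_mul_assoc]
  refine ⟨H, ?_, fun p X => ?_⟩
  · refine contMDiff_of_eq_on_tangent (G := fun x => (1 / 2 : ℝ) • (x.2 * x.1⁻¹))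
      (isSmoothForm_d hf.1) hβs ((contDiffOn_snd.mul
      (contDiffOn_inv_quaternion.comp contDiffOn_fst fun _ hx => hx)).const_smul _)
      (fun p X hX => hf.d_ne_zero p hX) ?_
    intro p X hX
    rw [← smul_mul_assoc, ← hH, mul_assoc, mul_inv_cancel₀ (hf.d_ne_zero p hX), mul_one]
  · rw [hH, two_mul, ← hβ]
    module

/-- The first-order equation of `H` in terms of the left normal, `2 df H = dN - N *dN`.  It comes
from the two expressions `dN ∧ df = df ∧ dR` for `d*df`. -/
lemma IsMeanCurvature.left (hH : IsMeanCurvature f R H) (hf : IsConformalImmersion f)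
    (hN : IsLeftNormal f N) (hR : IsRightNormal f R) (p : M) (X : ℂ) :
    2 * (d f p X * H p) = d N p X - N p * d N p (Complex.I * X) := by
  rcases eq_or_ne X 0 with rfl | hX
  · simp
  have hNs := hN.contMDiff hf
  have hRs := hR.contMDiff hf
  have hdf := isSmoothForm_d hf.1
  have e1 : starForm (d f) = mulForm mulL N (d f) := by
    funext p; ext1 X; exact hN.2 p X
  have e2 : starForm (d f) = (-1 : ℝ) • mulForm mulL.flip R (d f) := by
    funext p; ext1 X; exact (hR.2 p X).trans (neg_one_smul ℝ _).symm
  have e3 := extD_mulForm hdf hNs mulL p X (Complex.I * X)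
  have e4 := extD_smul (hdf.mulForm hRs mulL.flip) (-1) p X (Complex.I * X)
  rw [← e2, e1, e3, extD_mulForm hdf hRs, extD_d hf.1, neg_one_smul] at e4
  simp only [ContinuousLinearMap.flip_apply, ContinuousLinearMap.mul_apply', mul_zero, zero_mul,
    add_zero] at e4
  have h3 := hN.2 p X
  have h4 := mul_self_of_mem_imSphere (hR.1 p)
  have h5 := mul_self_of_mem_imSphere (hN.1 p)
  have h6 := mul_d_of_mem_imSphere hN.1 hNs p X
  have h7 := mul_d_eq_neg_d_mul hN hR p X
  have h8 := hH p X
  rw [starForm_apply] at h3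
  rw [h3] at e4
  apply mul_right_cancel₀ (hf.d_ne_zero p hX)
  linear_combination (norm := skip) d f p X * h8 - h7 * d R p (Complex.I * X) - N p * e4 +
    h5 * (d f p X * d R p X) + h6 * (N p * d f p X) - d N p X * h5 * d f p X
  simp only [two_mul, mul_add, add_mul, mul_sub, sub_mul, mul_assoc, neg_mul, mul_neg, one_mul,
    mul_one]
  abel

end Surface

/-! ### Linear algebra of `ℍ²` -/

section LinearAlgebra

variable {M : Type*} {f : M → ℍ[ℝ]} {p : M}

lemma mem_line {v : V} : v ∈ line f p ↔ v 0 = f p * v 1 := by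
  rw [line, Submodule.mem_span_singleton]
  constructor
  · rintro ⟨a, rfl⟩
    simp
  · intro h
    refine ⟨MulOpposite.op (v 1), ?_⟩
    ext1 i
    fin_cases i <;> simp [h]

lemma mem_lineInfty {v : V} : v ∈ lineInfty ↔ v 1 = 0 := by
  rw [lineInfty, Submodule.mem_span_singleton]
  constructor
  · rintro ⟨a, rfl⟩
    simp
  · intro h
    refine ⟨MulOpposite.op (v 0), ?_⟩
    ext1 i
    fin_cases i <;> simp [h]

lemma eq_smul_of_mem_line {v : V} (hv : v ∈ line f p) :
    v = MulOpposite.op (v 1) • ![f p, 1] := by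
  ext1 i
  fin_cases i
  · exact mem_line.1 hv
  · exact (one_mul _).symm

namespace IsQuatLinear

variable {A B : EndV}

/-- A quaternionic linear map in terms of its values on the basis `(1, 0)`, `(x, 1)`. -/
lemma apply_eq (hB : IsQuatLinear B) (x : ℍ[ℝ]) (v : V) (i : Fin 2) :
    B v i = B ![1, 0] i * (v 0 - x * v 1) + B ![x, 1] i * v 1 := by
  have h : v = MulOpposite.op (v 0 - x * v 1) • ![1, 0] + MulOpposite.op (v 1) • ![x, 1] := by
    ext1 i
    fin_cases i <;> simp
  nth_rewrite 1 [h]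
  rw [map_add, hB, hB]
  rfl

lemma ext_basis (hA : IsQuatLinear A) (hB : IsQuatLinear B) (x : ℍ[ℝ])
    (h0 : A ![1, 0] = B ![1, 0]) (h1 : A ![x, 1] = B ![x, 1]) : A = B := by
  refine ContinuousLinearMap.ext fun v => funext fun i => ?_
  rw [hA.apply_eq x, hB.apply_eq x, h0, h1]

lemma add (hA : IsQuatLinear A) (hB : IsQuatLinear B) : IsQuatLinear (A + B) := fun a v => by
  rw [add_apply, add_apply, hA, hB, smul_add]

lemma smul (hA : IsQuatLinear A) (c : ℝ) : IsQuatLinear (c • A) := fun a v => by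
  rw [smul_apply, smul_apply, hA, smul_comm]

lemma sub (hA : IsQuatLinear A) (hB : IsQuatLinear B) : IsQuatLinear (A - B) := fun a v => by
  rw [sub_apply, sub_apply, hA, hB, smul_sub]

lemma comp (hA : IsQuatLinear A) (hB : IsQuatLinear B) : IsQuatLinear (A.comp B) := fun a v => by
  rw [ContinuousLinearMap.comp_apply, hB, hA]; rfl

end IsQuatLinear

/-- The endomorphism of `ℍ²` whose matrix has the entry `x` at `(i, j)` and zeros elsewhere. -/
def matUnit (i j : Fin 2) : ℍ[ℝ] →L[ℝ] EndV :=
  (ContinuousLinearMap.compL ℝ V ℍ[ℝ] V (ContinuousLinearMap.single ℝ (fun _ => ℍ[ℝ]) i)).comp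
    (((ContinuousLinearMap.compL ℝ V ℍ[ℝ] ℍ[ℝ]).flip (ContinuousLinearMap.proj j)).comp mulL)

lemma matUnit_apply (i j : Fin 2) (x : ℍ[ℝ]) (v : V) :
    matUnit i j x v = Pi.single i (x * v j) := rfl

lemma isQuatLinear_matUnit (i j : Fin 2) (x : ℍ[ℝ]) : IsQuatLinear (matUnit i j x) := by
  intro a v
  ext1 k
  rw [matUnit_apply, matUnit_apply, Pi.smul_apply, Pi.smul_apply]
  rcases eq_or_ne k i with rfl | h
  · simp [mul_assoc]
  · simp [Pi.single_eq_of_ne h]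

end LinearAlgebra

/-! ### Endomorphism fields adapted to the frame `(1, 0)`, `(f, 1)` -/

section Fields

variable {M : Type*} [TopologicalSpace M] [ChartedSpace ℂ M]
variable {f N R H : M → ℍ[ℝ]} {S : M → EndV} {a b : M → ℍ[ℝ]}

/-- The smooth field `S` of endomorphisms given by `S e = e N - ψ H` and `S ψ = -ψ R` in the
frame `e = (1, 0)`, `ψ = (f, 1)`. -/
structure IsSphereField (f N R H : M → ℍ[ℝ]) (S : M → EndV) : Prop where
  smooth : ContMDiff 𝓘(ℝ, ℂ) 𝓘(ℝ, EndV) ∞ S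
  quatLinear : ∀ p, IsQuatLinear (S p)
  apply_infty : ∀ p, S p ![1, 0] = ![N p - f p * H p, -H p]
  apply_lift : ∀ p, S p ![f p, 1] = ![-(f p * R p), -R p]

namespace IsSphereField

lemma apply (hS : IsSphereField f N R H S) (p : M) (v : V) :
    S p v = ![N p * (v 0 - f p * v 1) - f p * (H p * (v 0 - f p * v 1) + R p * v 1),
      -(H p * (v 0 - f p * v 1) + R p * v 1)] := by
  ext1 i
  rw [(hS.quatLinear p).apply_eq (f p), hS.apply_infty, hS.apply_lift]
  fin_cases i <;> simp <;> noncomm_ring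

lemma eq_of_eq {S' : M → EndV} (hS : IsSphereField f N R H S) (hS' : IsSphereField f N R H S') :
    S = S' := by
  funext p
  exact (hS.quatLinear p).ext_basis (hS'.quatLinear p) (f p)
    ((hS.apply_infty p).trans (hS'.apply_infty p).symm)
    ((hS.apply_lift p).trans (hS'.apply_lift p).symm)

lemma apply_line (hS : IsSphereField f N R H S) (p : M) (x : ℍ[ℝ]) :
    S p ![f p * x, x] = ![f p * -(R p * x), -(R p * x)] := by
  rw [hS.apply]
  simp

/-- `S` induces left multiplication by `N` on `V / L`. -/
lemma apply_mod_line (hS : IsSphereField f N R H S) (p : M) (v : V) :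
    S p v 0 - f p * S p v 1 = N p * (v 0 - f p * v 1) := by
  rw [hS.apply]
  simp only [Matrix.cons_val_zero, Matrix.cons_val_one]
  noncomm_ring

end IsSphereField

variable [IsManifold 𝓘(ℂ) ω M]

lemma contMDiff_vec (ha : ContMDiff 𝓘(ℝ, ℂ) 𝓘(ℝ, ℍ[ℝ]) ∞ a)
    (hb : ContMDiff 𝓘(ℝ, ℂ) 𝓘(ℝ, ℍ[ℝ]) ∞ b) :
    ContMDiff 𝓘(ℝ, ℂ) 𝓘(ℝ, V) ∞ (fun q => (![a q, b q] : V)) :=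
  contMDiff_of_contDiffOn_chart fun p => contDiffOn_pi.2 fun i => by
    fin_cases i
    · exact ha.contDiffOn_chart p
    · exact hb.contDiffOn_chart p

lemma _root_.ContMDiff.coord {Ψ : M → V} (h : ContMDiff 𝓘(ℝ, ℂ) 𝓘(ℝ, V) ∞ Ψ) (i : Fin 2) :
    ContMDiff 𝓘(ℝ, ℂ) 𝓘(ℝ, ℍ[ℝ]) ∞ (fun q => Ψ q i) :=
  h.clm_map (ContinuousLinearMap.proj (R := ℝ) (φ := fun _ : Fin 2 => ℍ[ℝ]) i)

lemma d_coord {Ψ : M → V} (h : ContMDiff 𝓘(ℝ, ℂ) 𝓘(ℝ, V) ∞ Ψ) (p : M) (X : ℂ) (i : Fin 2) :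
    d Ψ p X i = d (fun q => Ψ q i) p X :=
  (d_clm h (ContinuousLinearMap.proj (R := ℝ) (φ := fun _ : Fin 2 => ℍ[ℝ]) i) p X).symm

lemma d_vec (ha : ContMDiff 𝓘(ℝ, ℂ) 𝓘(ℝ, ℍ[ℝ]) ∞ a)
    (hb : ContMDiff 𝓘(ℝ, ℂ) 𝓘(ℝ, ℍ[ℝ]) ∞ b) (p : M) (X : ℂ) :
    d (fun q => (![a q, b q] : V)) p X = ![d a p X, d b p X] := by
  ext1 i
  rw [d_coord (contMDiff_vec ha hb)]
  fin_cases i <;> rfl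

lemma d_mul (ha : ContMDiff 𝓘(ℝ, ℂ) 𝓘(ℝ, ℍ[ℝ]) ∞ a)
    (hb : ContMDiff 𝓘(ℝ, ℂ) 𝓘(ℝ, ℍ[ℝ]) ∞ b) (p : M) (X : ℂ) :
    d (fun q => a q * b q) p X = d a p X * b p + a p * d b p X :=
  d_bilin ha hb mulL p X

lemma d_neg (ha : ContMDiff 𝓘(ℝ, ℂ) 𝓘(ℝ, ℍ[ℝ]) ∞ a) (p : M) (X : ℂ) :
    d (fun q => -a q) p X = -d a p X :=
  d_clm ha (-ContinuousLinearMap.id ℝ ℍ[ℝ]) p X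

lemma _root_.ContMDiff.quat_mul (ha : ContMDiff 𝓘(ℝ, ℂ) 𝓘(ℝ, ℍ[ℝ]) ∞ a)
    (hb : ContMDiff 𝓘(ℝ, ℂ) 𝓘(ℝ, ℍ[ℝ]) ∞ b) :
    ContMDiff 𝓘(ℝ, ℂ) 𝓘(ℝ, ℍ[ℝ]) ∞ (fun q => a q * b q) := ha.bilin hb mulL

lemma d_endomorphism_apply (hS : ContMDiff 𝓘(ℝ, ℂ) 𝓘(ℝ, EndV) ∞ S) (p : M) (X : ℂ) (v : V) :
    d S p X v = d (fun q => S q v) p X :=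
  (d_clm hS (ContinuousLinearMap.apply ℝ V v) p X).symm

/-- The derivative of a field of quaternionic linear maps is quaternionic linear. -/
lemma isQuatLinear_d (hS : ContMDiff 𝓘(ℝ, ℂ) 𝓘(ℝ, EndV) ∞ S) (hq : ∀ p, IsQuatLinear (S p))
    (p : M) (X : ℂ) : IsQuatLinear (d S p X) := by
  intro c v
  let T : EndV →L[ℝ] V := ContinuousLinearMap.apply ℝ V (c • v) -
    (c • ContinuousLinearMap.id ℝ V).comp (ContinuousLinearMap.apply ℝ V v)
  have h : (fun q => T (S q)) = fun _ => 0 := funext fun q => sub_eq_zero.2 (hq q c v)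
  have h2 := d_clm hS T p X
  rw [h, d_const] at h2
  exact sub_eq_zero.1 h2.symm

lemma exists_isSphereField (hf : ContMDiff 𝓘(ℝ, ℂ) 𝓘(ℝ, ℍ[ℝ]) ∞ f)
    (hN : ContMDiff 𝓘(ℝ, ℂ) 𝓘(ℝ, ℍ[ℝ]) ∞ N) (hR : ContMDiff 𝓘(ℝ, ℂ) 𝓘(ℝ, ℍ[ℝ]) ∞ R)
    (hH : ContMDiff 𝓘(ℝ, ℂ) 𝓘(ℝ, ℍ[ℝ]) ∞ H) : ∃ S, IsSphereField f N R H S := by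
  have h00 : ContMDiff 𝓘(ℝ, ℂ) 𝓘(ℝ, ℍ[ℝ]) ∞ (fun q => N q - f q * H q) := hN.sub (hf.quat_mul hH)
  have h11 : ContMDiff 𝓘(ℝ, ℂ) 𝓘(ℝ, ℍ[ℝ]) ∞ (fun q => H q * f q - R q) := (hH.quat_mul hf).sub hR
  have h01 : ContMDiff 𝓘(ℝ, ℂ) 𝓘(ℝ, ℍ[ℝ]) ∞
      (fun q => -((N q - f q * H q) * f q) - f q * R q) :=
    (h00.quat_mul hf).neg.sub (hf.quat_mul hR)
  have h10 : ContMDiff 𝓘(ℝ, ℂ) 𝓘(ℝ, ℍ[ℝ]) ∞ (fun q => -H q) := hH.neg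
  refine ⟨fun q => matUnit 0 0 (N q - f q * H q) +
    matUnit 0 1 (-((N q - f q * H q) * f q) - f q * R q) + matUnit 1 0 (-H q) +
    matUnit 1 1 (H q * f q - R q), ?_, ?_, ?_, ?_⟩
  · exact (((h00.clm_map _).add (h01.clm_map _)).add (h10.clm_map _)).add (h11.clm_map _)
  · intro p
    exact (((isQuatLinear_matUnit _ _ _).add (isQuatLinear_matUnit _ _ _)).add
      (isQuatLinear_matUnit _ _ _)).add (isQuatLinear_matUnit _ _ _)
  · intro p
    ext1 i
    fin_cases i <;> simp [matUnit_apply]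
  · intro p
    ext1 i
    fin_cases i <;> simp [matUnit_apply] <;> noncomm_ring

namespace IsSphereField

lemma d_lift (hf : ContMDiff 𝓘(ℝ, ℂ) 𝓘(ℝ, ℍ[ℝ]) ∞ f) (p : M) (X : ℂ) :
    d (fun q => (![f q, 1] : V)) p X = ![d f p X, 0] := by
  rw [d_vec hf contMDiff_const, d_const]

/-- `(∇S) ψ = ψ (H df - dR)`. -/
lemma d_apply_lift (hS : IsSphereField f N R H S) (hf : IsConformalImmersion f)
    (hN : IsLeftNormal f N) (hR : IsRightNormal f R) (p : M) (X : ℂ) :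
    d S p X ![f p, 1] = ![f p * (H p * d f p X - d R p X), H p * d f p X - d R p X] := by
  have hRs := hR.contMDiff hf
  have hψ : ContMDiff 𝓘(ℝ, ℂ) 𝓘(ℝ, V) ∞ (fun q => (![f q, 1] : V)) :=
    contMDiff_vec hf.1 contMDiff_const
  have h := d_bilin hS.smooth hψ (ContinuousLinearMap.id ℝ EndV) p X
  simp only [ContinuousLinearMap.id_apply, hS.apply_lift] at h
  rw [d_vec (hf.1.quat_mul hRs).neg hRs.neg, d_neg (hf.1.quat_mul hRs), d_neg hRs,
    d_mul hf.1 hRs, d_lift hf.1, hS.apply] at h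
  rw [eq_sub_of_add_eq h.symm]
  have h7 := mul_d_eq_neg_d_mul hN hR p X
  ext1 i
  fin_cases i
  · simp [h7]
    noncomm_ring
  · simp
    noncomm_ring

/-- `(∇S) e = e (dN - df H) - ψ dH`. -/
lemma d_apply_infty (hS : IsSphereField f N R H S) (hf : ContMDiff 𝓘(ℝ, ℂ) 𝓘(ℝ, ℍ[ℝ]) ∞ f)
    (hN : ContMDiff 𝓘(ℝ, ℂ) 𝓘(ℝ, ℍ[ℝ]) ∞ N) (p : M) (X : ℂ) :
    d S p X ![1, 0] = ![d N p X - d f p X * H p - f p * d H p X, -d H p X] := by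
  have hH : ContMDiff 𝓘(ℝ, ℂ) 𝓘(ℝ, ℍ[ℝ]) ∞ H := by
    have h := (hS.smooth.clm_map (ContinuousLinearMap.apply ℝ V ![1, 0])).coord 1
    simp only [ContinuousLinearMap.apply_apply, hS.apply_infty] at h
    have h' := ContMDiff.neg h
    simpa using h'
  have h0 : ContMDiff 𝓘(ℝ, ℂ) 𝓘(ℝ, ℍ[ℝ]) ∞ (fun q => N q + -(f q * H q)) :=
    hN.add (hf.quat_mul hH).neg
  rw [d_endomorphism_apply hS.smooth]
  simp only [hS.apply_infty, sub_eq_add_neg]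
  rw [d_vec h0 hH.neg, d_add (G := fun q => -(f q * H q)) hN (hf.quat_mul hH).neg,
    d_neg (hf.quat_mul hH), d_neg hH, d_mul hf hH]
  ext1 i
  fin_cases i <;> simp
  abel

end IsSphereField
end Fields

/-! ### The mean curvature sphere congruence and its Hopf fields -/

section Main

variable {M : Type*} [TopologicalSpace M] [ChartedSpace ℂ M]
variable {f N R H : M → ℍ[ℝ]} {S : M → EndV} {η : OneForm M EndV}

lemma hopfQ_apply (p : M) (X : ℂ) (v : V) : hopfQ S p X v =
    (1 / 4 : ℝ) • (S p (d S p X v) - d S p (Complex.I * X) v) := rfl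

lemma twoStarA_apply (p : M) (X : ℂ) (v : V) : twoStarA S η p X v =
    (1 / 2 : ℝ) • (S p (d S p (Complex.I * X) v) - d S p X v) + η p X v := by
  change (2 : ℝ) • ((1 / 4 : ℝ) • (S p (d S p (Complex.I * X) v) +
    d S p (Complex.I * (Complex.I * X)) v)) + η p X v = _
  rw [I_mul_I_mul, map_neg, neg_apply]
  module

lemma twoStarQ_apply (p : M) (X : ℂ) (v : V) : twoStarQ S η p X v =
    (1 / 2 : ℝ) • (S p (d S p (Complex.I * X) v) + d S p X v) + η p X v := by
  change (2 : ℝ) • ((1 / 4 : ℝ) • (S p (d S p (Complex.I * X) v) -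
    d S p (Complex.I * (Complex.I * X)) v)) + η p X v = _
  rw [I_mul_I_mul, map_neg, neg_apply]
  module

lemma isQuatLinear_zero : IsQuatLinear 0 := fun _ _ => by simp

/-- `2*Q - 2*A = dS` is exact. -/
lemma twoStarQ_eq_twoStarA_add_d : twoStarQ S η = twoStarA S η + d S := by
  funext p
  refine ContinuousLinearMap.ext fun X => ContinuousLinearMap.ext fun v => ?_
  rw [Pi.add_apply, add_apply, add_apply, twoStarQ_apply, twoStarA_apply]
  module

/-- A quaternionic linear 1-form `η` with `η e ∈ L` and `η ψ = 0` is a multiplier. -/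
lemma isMultiplier_of_basis (hs : IsSmoothForm η) (hq : ∀ p X, IsQuatLinear (η p X))
    (h0 : ∀ p X, η p X ![1, 0] ∈ line f p) (h1 : ∀ p X, η p X ![f p, 1] = 0) :
    IsMultiplier f η := by
  refine ⟨hs, fun p X => ⟨hq p X, fun v => ?_, fun v hv => ?_⟩⟩
  · rw [mem_line, (hq p X).apply_eq (f p) v, (hq p X).apply_eq (f p) v, h1, mem_line.1 (h0 p X)]
    simp [mul_assoc]
  · rw [eq_smul_of_mem_line hv, hq, h1, smul_zero]

/-- The 1-form `2*A + η` vanishing at `∞`: it maps `e` to `0` and `ψ` to `½ ψ (dR + R *dR)`. -/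
def rightForm (f R : M → ℍ[ℝ]) : OneForm M EndV :=
  (1 / 2 : ℝ) • (mapForm (matUnit 0 1) (mulForm mulL f (barForm R)) +
    mapForm (matUnit 1 1) (barForm R))

/-- The 1-form `2*Q + η` with values in the line `∞`: it maps `e` to `½ e (dN + N *dN)` and
`ψ` to `0`. -/
def leftForm (f N : M → ℍ[ℝ]) : OneForm M EndV :=
  (1 / 2 : ℝ) • (mapForm (matUnit 0 0) (barForm N) +
    mapForm (matUnit 0 1) (mulForm (-mulL.flip) f (barForm N)))

lemma rightForm_apply (p : M) (X : ℂ) (v : V) : rightForm f R p X v =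
    (1 / 2 : ℝ) • ![f p * barForm R p X * v 1, barForm R p X * v 1] := by
  change (1 / 2 : ℝ) • (matUnit 0 1 (f p * barForm R p X) v + matUnit 1 1 (barForm R p X) v) = _
  congr 1
  ext1 i
  fin_cases i <;> simp [matUnit_apply]

lemma leftForm_apply (p : M) (X : ℂ) (v : V) : leftForm f N p X v =
    (1 / 2 : ℝ) • ![barForm N p X * (v 0 - f p * v 1), 0] := by
  change (1 / 2 : ℝ) • (matUnit 0 0 (barForm N p X) v +
    matUnit 0 1 (-(barForm N p X * f p)) v) = _
  congr 1
  ext1 i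
  fin_cases i <;> simp [matUnit_apply, mul_add, mul_assoc, sub_eq_add_neg]

lemma isQuatLinear_rightForm (p : M) (X : ℂ) : IsQuatLinear (rightForm f R p X) :=
  ((isQuatLinear_matUnit _ _ _).add (isQuatLinear_matUnit _ _ _)).smul _

lemma isQuatLinear_leftForm (p : M) (X : ℂ) : IsQuatLinear (leftForm f N p X) :=
  ((isQuatLinear_matUnit _ _ _).add (isQuatLinear_matUnit _ _ _)).smul _

variable [IsManifold 𝓘(ℂ) ω M]

/-- The form of the mean curvature sphere congruence in the frame `e = (1, 0)`, `ψ = (f, 1)`. -/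
lemma IsMeanCurvatureSphere.isSphereField (hS : IsMeanCurvatureSphere f S)
    (hf : IsConformalImmersion f) (hN : IsLeftNormal f N) (hR : IsRightNormal f R) :
    ∃ H, IsSphereField f N R H S ∧ IsMeanCurvature f R H := by
  have hψ : ContMDiff 𝓘(ℝ, ℂ) 𝓘(ℝ, V) ∞ (fun q => (![f q, 1] : V)) :=
    contMDiff_vec hf.1 contMDiff_const
  have hsec : IsSection f (fun q => (![f q, 1] : V)) := ⟨hψ, fun p => mem_line.2 (by simp)⟩
  have hdψ := IsSphereField.d_lift hf.1
  have h1 (p : M) : d f p 1 ≠ 0 := hf.d_ne_zero p one_ne_zero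
  -- `S ψ = ψ μ` with `μ` the second coordinate, and `*δ = δS` gives `μ = -R`
  let μ : M → ℍ[ℝ] := fun q => S q ![f q, 1] 1
  have hμs : ContMDiff 𝓘(ℝ, ℂ) 𝓘(ℝ, ℍ[ℝ]) ∞ μ :=
    (hS.smooth.bilin hψ (ContinuousLinearMap.id ℝ EndV)).coord 1
  have hSψ (p : M) : S p ![f p, 1] = ![f p * μ p, μ p] := by
    have h : S p ![f p, 1] ∈ (line f p : Set V) := hS.map_line p ▸ ⟨_, hsec.2 p, rfl⟩
    ext1 i
    fin_cases i
    · exact mem_line.1 h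
    · rfl
  have hδ (p : M) (X : ℂ) : d f p X * μ p = d f p X * -R p := by
    have h := mem_line.1 (hS.star_delta_eq_delta_S _ hsec p X)
    simp only [hSψ] at h
    have h2 := hR.2 p X
    rw [d_vec (hf.1.quat_mul hμs) hμs, d_mul hf.1 hμs, starForm_apply, hdψ] at h
    rw [starForm_apply] at h2
    simp only [Pi.sub_apply, Matrix.cons_val_zero, Matrix.cons_val_one, h2] at h
    linear_combination (norm := noncomm_ring) -h
  have hμ (p : M) : μ p = -R p := mul_left_cancel₀ (h1 p) (hδ p 1)
  -- `*δ = Sδ` determines `S e` modulo `L`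
  let H : M → ℍ[ℝ] := fun q => -S q ![1, 0] 1
  have hδ' (p : M) (X : ℂ) : S p ![1, 0] 0 * d f p X = (N p - f p * H p) * d f p X := by
    have h := mem_line.1 (hS.star_delta_eq_S_delta _ hsec p X)
    rw [starForm_apply, hdψ, hdψ] at h
    rw [Pi.sub_apply, Pi.sub_apply, (hS.quatLinear p).apply_eq (f p) ![d f p X, 0] 0,
      (hS.quatLinear p).apply_eq (f p) ![d f p X, 0] 1] at h
    have h2 := hN.2 p X
    rw [starForm_apply] at h2
    simp only [Matrix.cons_val_zero, Matrix.cons_val_one, h2] at h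
    simp only [H]
    linear_combination (norm := noncomm_ring) -h
  have hSe (p : M) : S p ![1, 0] = ![N p - f p * H p, -H p] := by
    ext1 i
    fin_cases i
    · exact mul_right_cancel₀ (h1 p) (hδ' p 1)
    · simp [H]
  have hSF : IsSphereField f N R H S := ⟨hS.smooth, hS.quatLinear, hSe, fun p => by
    rw [hSψ, hμ, mul_neg]⟩
  refine ⟨H, hSF, fun p X => ?_⟩
  have hR2 := mul_self_of_mem_imSphere (hR.1 p)
  -- the lower left entry of `S² = -1`
  have hHN : H p * N p = R p * H p := by
    have h := DFunLike.congr_fun (hS.sq p) ![1, 0]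
    change S p (S p ![1, 0]) = -![1, 0] at h
    rw [hSe, hSF.apply] at h
    have h' := congrFun h 1
    simp at h'
    linear_combination (norm := noncomm_ring) -h'
  -- `Q ψ = 0` is the equation of `H`
  have hQ := hS.hopfQ_line p X _ (hsec.2 p)
  rw [hopfQ_apply, smul_eq_zero, or_iff_right (by norm_num), hSF.d_apply_lift hf hN hR,
    hSF.d_apply_lift hf hN hR, hSF.apply] at hQ
  have hQ' := congrFun hQ 1
  have h2 := hN.2 p X
  rw [starForm_apply] at h2
  simp [h2] at hQ'
  linear_combination (norm := skip) R p * hQ' + R p * hHN * d f p X +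
    hR2 * (2 * (H p * d f p X)) - hR2 * d R p X
  simp only [two_mul, mul_add, mul_sub, mul_assoc, neg_mul, mul_neg, one_mul,
    mul_zero]
  abel

namespace IsSphereField

/-- `2 (∇S) ψ = -ψ (dR + R *dR)`. -/
lemma d_apply_lift_eq_barForm (hS : IsSphereField f N R H S) (hf : IsConformalImmersion f)
    (hN : IsLeftNormal f N) (hR : IsRightNormal f R) (hH : IsMeanCurvature f R H)
    (p : M) (X : ℂ) :
    d S p X ![f p, 1] = (-(1 / 2) : ℝ) • ![f p * barForm R p X, barForm R p X] := by
  have h : H p * d f p X - d R p X = (-(1 / 2) : ℝ) • barForm R p X := by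
    have h1 := hH p X
    rw [two_mul] at h1
    have h2 : (2 : ℝ) • (H p * d f p X) = d R p X - R p * d R p (Complex.I * X) := by
      rw [two_smul, h1]
    rw [barForm_apply]
    linear_combination (norm := module) (1 / 2 : ℝ) • h2
  rw [hS.d_apply_lift hf hN hR, h, mul_smul_comm]
  ext1 i
  fin_cases i <;> rfl

/-- `2 (∇S) e = e (dN + N *dN)` modulo `L`. -/
lemma d_apply_infty_mod_line (hS : IsSphereField f N R H S) (hf : IsConformalImmersion f)
    (hN : IsLeftNormal f N) (hR : IsRightNormal f R) (hH : IsMeanCurvature f R H)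
    (p : M) (X : ℂ) :
    d S p X ![1, 0] 0 - f p * d S p X ![1, 0] 1 = (1 / 2 : ℝ) • barForm N p X := by
  have h1 := hH.left hf hN hR p X
  rw [two_mul] at h1
  have h2 : (2 : ℝ) • (d f p X * H p) = d N p X - N p * d N p (Complex.I * X) := by
    rw [two_smul, h1]
  rw [hS.d_apply_infty hf.1 (hN.contMDiff hf), barForm_apply]
  simp only [Matrix.cons_val_zero, Matrix.cons_val_one, mul_neg]
  linear_combination (norm := module) (-(1 / 2) : ℝ) • h2

/-- `S (∇S) ψ = *(∇S) ψ`, that is, `Q ψ = 0`. -/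
lemma apply_d_apply_lift (hS : IsSphereField f N R H S) (hf : IsConformalImmersion f)
    (hN : IsLeftNormal f N) (hR : IsRightNormal f R) (hH : IsMeanCurvature f R H)
    (p : M) (X : ℂ) : S p (d S p X ![f p, 1]) = d S p (Complex.I * X) ![f p, 1] := by
  rw [hS.d_apply_lift_eq_barForm hf hN hR hH, hS.d_apply_lift_eq_barForm hf hN hR hH, map_smul,
    hS.apply_line, barForm_I_mul hR.1]

lemma isMeanCurvatureSphere (hS : IsSphereField f N R H S)
    (hf : IsConformalImmersion f) (hN : IsLeftNormal f N) (hR : IsRightNormal f R)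
    (hH : IsMeanCurvature f R H) : IsMeanCurvatureSphere f S := by
  have hRs := hR.contMDiff hf
  have hHN := hH.mul_left_normal hf hN hR
  have hsq (p : M) (v : V) : S p (S p v) = -v := by
    have hN2 := mul_self_of_mem_imSphere (hN.1 p)
    have hR2 := mul_self_of_mem_imSphere (hR.1 p)
    have hHN := hHN p
    have h1 : S p v 1 = -(H p * (v 0 - f p * v 1) + R p * v 1) := by
      rw [hS.apply]; rfl
    have h2 : H p * (N p * (v 0 - f p * v 1)) + R p * S p v 1 = v 1 := by
      rw [h1]
      linear_combination (norm := skip) hHN * (v 0 - f p * v 1) - hR2 * v 1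
      simp only [mul_add, mul_sub, mul_assoc, neg_mul, mul_neg, one_mul]
      abel
    rw [hS.apply p (S p v), hS.apply_mod_line, h2, ← mul_assoc (N p), hN2]
    ext1 i
    fin_cases i <;> simp
  have hline (p : M) (v : V) (hv : v ∈ line f p) : S p v ∈ line f p := by
    rw [mem_line, hS.apply]
    simp [mem_line.1 hv]
  have hsec (ψ : M → V) (hψ : IsSection f ψ) : ψ = fun q => ![f q * ψ q 1, ψ q 1] := by
    funext q i
    fin_cases i
    · exact mem_line.1 (hψ.2 q)
    · rfl
  have hd (ψ : M → V) (hψ : IsSection f ψ) (p : M) (X : ℂ) :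
      d ψ p X = ![d f p X * ψ p 1 + f p * d (fun q => ψ q 1) p X, d (fun q => ψ q 1) p X] := by
    have hb := hψ.1.coord 1
    rw [hsec ψ hψ, d_vec (hf.1.quat_mul hb) hb, d_mul hf.1 hb]
    rfl
  refine ⟨hS.smooth, hS.quatLinear, fun p => ContinuousLinearMap.ext (hsq p), ?_, ?_, ?_, ?_⟩
  · intro p
    apply Set.Subset.antisymm
    · rintro _ ⟨v, hv, rfl⟩
      exact hline p v hv
    · intro v hv
      exact ⟨-S p v, neg_mem (hline p v hv), by rw [map_neg, hsq, neg_neg]⟩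
  · intro ψ hψ p X
    have h2 := hN.2 p X
    rw [starForm_apply] at h2
    rw [mem_line, starForm_apply, hS.apply, hd ψ hψ, hd ψ hψ]
    simp [h2]
    noncomm_ring
  · intro ψ hψ p X
    have h2 := hR.2 p X
    have hb := hψ.1.coord 1
    have hRb := hRs.quat_mul hb
    rw [starForm_apply] at h2
    have hSψ : (fun q => S q (ψ q)) = fun q => ![-(f q * (R q * ψ q 1)), -(R q * ψ q 1)] := by
      funext q
      rw [hS.apply, mem_line.1 (hψ.2 q)]
      simp
    rw [mem_line, starForm_apply, hSψ, d_vec (hf.1.quat_mul hRb).neg hRb.neg,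
      d_neg (hf.1.quat_mul hRb), d_neg hRb, d_mul hf.1 hRb, hd ψ hψ]
    simp [h2]
    noncomm_ring
  · intro p X v hv
    have hq := isQuatLinear_d hS.smooth hS.quatLinear p
    rw [hopfQ_apply, eq_smul_of_mem_line hv, hq, hq, hS.quatLinear,
      hS.apply_d_apply_lift hf hN hR hH, sub_self, smul_zero]

end IsSphereField


lemma isSmoothForm_fieldMul {α : OneForm M EndV} (hα : IsSmoothForm α)
    (hS : ContMDiff 𝓘(ℝ, ℂ) 𝓘(ℝ, EndV) ∞ S) : IsSmoothForm (fieldMul S α) :=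
  hα.mulForm hS (ContinuousLinearMap.compL ℝ V V V)

lemma isSmoothForm_twoStarA (hS : ContMDiff 𝓘(ℝ, ℂ) 𝓘(ℝ, EndV) ∞ S) (hη : IsSmoothForm η) :
    IsSmoothForm (twoStarA S η) :=
  ((((isSmoothForm_fieldMul (isSmoothForm_d hS) hS).add
    (isSmoothForm_d hS).starForm).smul _).starForm.smul _).add hη

lemma isSmoothForm_twoStarQ (hS : ContMDiff 𝓘(ℝ, ℂ) 𝓘(ℝ, EndV) ∞ S) (hη : IsSmoothForm η) :
    IsSmoothForm (twoStarQ S η) :=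
  ((((isSmoothForm_fieldMul (isSmoothForm_d hS) hS).sub
    (isSmoothForm_d hS).starForm).smul _).starForm.smul _).add hη

lemma isQuatLinear_twoStarA (hS : ContMDiff 𝓘(ℝ, ℂ) 𝓘(ℝ, EndV) ∞ S)
    (hq : ∀ p, IsQuatLinear (S p)) (hη : ∀ p X, IsQuatLinear (η p X)) (p : M) (X : ℂ) :
    IsQuatLinear (twoStarA S η p X) :=
  (((((hq p).comp (isQuatLinear_d hS hq p _)).add (isQuatLinear_d hS hq p _)).smul _).smul _).add
    (hη p X)

lemma isQuatLinear_twoStarQ (hS : ContMDiff 𝓘(ℝ, ℂ) 𝓘(ℝ, EndV) ∞ S)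
    (hq : ∀ p, IsQuatLinear (S p)) (hη : ∀ p X, IsQuatLinear (η p X)) (p : M) (X : ℂ) :
    IsQuatLinear (twoStarQ S η p X) :=
  (((((hq p).comp (isQuatLinear_d hS hq p _)).sub (isQuatLinear_d hS hq p _)).smul _).smul _).add
    (hη p X)

lemma isClosedForm_twoStarA (hS : ContMDiff 𝓘(ℝ, ℂ) 𝓘(ℝ, EndV) ∞ S) (hη : IsSmoothForm η)
    (h : IsClosedForm (twoStarQ S η)) : IsClosedForm (twoStarA S η) := by
  intro p X Y
  have h1 := h p X Y
  rwa [twoStarQ_eq_twoStarA_add_d, extD_add (isSmoothForm_twoStarA hS hη) (isSmoothForm_d hS),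
    extD_d hS, add_zero] at h1

lemma isClosedForm_rightForm_iff (hf : IsConformalImmersion f) (hR : IsRightNormal f R) :
    IsClosedForm (rightForm f R) ↔ IsHarmonic R := by
  have hRs := hR.contMDiff hf
  have hβ := isSmoothForm_barForm hRs
  have hβf := hβ.mulForm hf.1 mulL
  have h01 : IsSmoothForm (mapForm (W₁ := EndV) (matUnit 0 1) _) := hβf.mapForm _
  have h11 : IsSmoothForm (mapForm (W₁ := EndV) (matUnit 1 1) _) := hβ.mapForm _
  rw [isHarmonic_iff_isClosedForm_barForm hR.1 hRs, isClosedForm_iff, isClosedForm_iff]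
  refine forall_congr' fun p => ?_
  -- `df ∧ (dR + R *dR) = 0` by type
  have hw : d f p 1 * barForm R p Complex.I - d f p Complex.I * barForm R p 1 = 0 := by
    have h1 := hR.2 p 1
    have h2 := barForm_I_mul hR.1 p 1
    rw [starForm_apply, mul_one] at h1
    rw [mul_one] at h2
    rw [h1, h2]
    noncomm_ring
  rw [rightForm, extD_smul (h01.add h11), extD_add h01 h11, extD_mapForm hβf,
    extD_mapForm hβ, extD_mulForm hβ hf.1]
  simp only [ContinuousLinearMap.mul_apply', hw, zero_add]
  constructor
  · intro h
    have h1 := congrFun (DFunLike.congr_fun h ![0, 1]) 1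
    simpa [matUnit_apply] using h1
  · intro h
    simp [h]

lemma isClosedForm_leftForm_iff (hf : IsConformalImmersion f) (hN : IsLeftNormal f N) :
    IsClosedForm (leftForm f N) ↔ IsHarmonic N := by
  have hNs := hN.contMDiff hf
  have hσ := isSmoothForm_barForm hNs
  have hσf := hσ.mulForm hf.1 (-mulL.flip)
  have h00 : IsSmoothForm (mapForm (W₁ := EndV) (matUnit 0 0) _) := hσ.mapForm _
  have h01 : IsSmoothForm (mapForm (W₁ := EndV) (matUnit 0 1) _) := hσf.mapForm _
  rw [isHarmonic_iff_isClosedForm_barForm hN.1 hNs, isClosedForm_iff, isClosedForm_iff]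
  refine forall_congr' fun p => ?_
  -- `(dN + N *dN) ∧ df = 0` by type
  have hw : (-mulL.flip) (d f p 1) (barForm N p Complex.I) -
      (-mulL.flip) (d f p Complex.I) (barForm N p 1) = 0 := by
    have h1 := hN.2 p 1
    have h2 := barForm_I_mul hN.1 p 1
    have h3 := mul_barForm hN.1 hNs p 1
    rw [starForm_apply, mul_one] at h1
    rw [mul_one, h3, neg_neg] at h2
    change -(barForm N p Complex.I * d f p 1) - -(barForm N p 1 * d f p Complex.I) = 0
    rw [h1, h2]
    noncomm_ring
  rw [leftForm, extD_smul (h00.add h01), extD_add h00 h01, extD_mapForm hσf,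
    extD_mapForm hσ, extD_mulForm hσ hf.1, hw, zero_add]
  constructor
  · intro h
    have h1 := congrFun (DFunLike.congr_fun h ![1, 0]) 0
    simpa [matUnit_apply] using h1
  · intro h
    simp [h]

namespace IsSphereField

lemma twoStarA_apply_lift (hS : IsSphereField f N R H S) (hf : IsConformalImmersion f)
    (hN : IsLeftNormal f N) (hR : IsRightNormal f R) (hH : IsMeanCurvature f R H)
    (hη : ∀ p X, η p X ![f p, 1] = 0) (p : M) (X : ℂ) :
    twoStarA S η p X ![f p, 1] = rightForm f R p X ![f p, 1] := by
  rw [twoStarA_apply, hη, hS.apply_d_apply_lift hf hN hR hH, I_mul_I_mul, map_neg, neg_apply,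
    hS.d_apply_lift_eq_barForm hf hN hR hH, rightForm_apply]
  simp only [Matrix.cons_val_one, Matrix.cons_val_zero, mul_one]
  module

lemma twoStarA_apply_infty_mem (hS : IsSphereField f N R H S) (hf : IsConformalImmersion f)
    (hN : IsLeftNormal f N) (hR : IsRightNormal f R) (hH : IsMeanCurvature f R H)
    (p : M) (X : ℂ) : twoStarA S 0 p X ![1, 0] ∈ line f p := by
  have h1 := hS.apply_mod_line p (d S p (Complex.I * X) ![1, 0])
  have h2 := hS.d_apply_infty_mod_line hf hN hR hH p X
  have hN2 := mul_self_of_mem_imSphere (hN.1 p)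
  rw [hS.d_apply_infty_mod_line hf hN hR hH, barForm_I_mul hN.1, mul_smul_comm, mul_neg,
    ← mul_assoc, hN2, neg_one_mul, neg_neg, ← h2] at h1
  rw [twoStarA_apply]
  change (1 / 2 : ℝ) • _ + (0 : V) ∈ _
  rw [add_zero, mem_line]
  simp only [Pi.smul_apply, Pi.sub_apply, mul_smul_comm, mul_sub]
  rw [← sub_eq_zero, ← smul_sub, smul_eq_zero]
  right
  linear_combination (norm := abel) h1

lemma twoStarQ_apply_lift (hS : IsSphereField f N R H S) (hf : IsConformalImmersion f)
    (hN : IsLeftNormal f N) (hR : IsRightNormal f R) (hH : IsMeanCurvature f R H)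
    (hη : ∀ p X, η p X ![f p, 1] = 0) (p : M) (X : ℂ) : twoStarQ S η p X ![f p, 1] = 0 := by
  rw [twoStarQ_apply, hη, hS.apply_d_apply_lift hf hN hR hH, I_mul_I_mul, map_neg, neg_apply]
  simp

lemma twoStarQ_apply_infty_mod_line (hS : IsSphereField f N R H S) (hf : IsConformalImmersion f)
    (hN : IsLeftNormal f N) (hR : IsRightNormal f R) (hH : IsMeanCurvature f R H)
    {p : M} {X : ℂ} (hη : η p X ![1, 0] ∈ line f p) :
    twoStarQ S η p X ![1, 0] 0 - f p * twoStarQ S η p X ![1, 0] 1 =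
      (1 / 2 : ℝ) • barForm N p X := by
  have h1 := hS.apply_mod_line p (d S p (Complex.I * X) ![1, 0])
  have h2 := hS.d_apply_infty_mod_line hf hN hR hH p X
  have hN2 := mul_self_of_mem_imSphere (hN.1 p)
  rw [hS.d_apply_infty_mod_line hf hN hR hH, barForm_I_mul hN.1, mul_smul_comm, mul_neg,
    ← mul_assoc, hN2, neg_one_mul, neg_neg] at h1
  rw [twoStarQ_apply]
  simp only [Pi.smul_apply, Pi.add_apply, mul_smul_comm, mul_add, mem_line.1 hη]
  linear_combination (norm := module) (1 / 2 : ℝ) • h1 + (1 / 2 : ℝ) • h2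

end IsSphereField

/-! ### Harmonicity of the normals -/

lemma isHarmonic_rightNormal_iff (hf : IsConformalImmersion f) (hN : IsLeftNormal f N)
    (hR : IsRightNormal f R) (hS : IsMeanCurvatureSphere f S) :
    IsHarmonic R ↔ IsConstrainedWillmore f ∧ ∃ η, IsMultiplier f η ∧
      IsClosedForm (twoStarA S η) ∧ ∀ p X, ∀ v ∈ lineInfty, twoStarA S η p X v = 0 := by
  obtain ⟨H, hS', hH⟩ := hS.isSphereField hf hN hR
  rw [← isClosedForm_rightForm_iff hf hR]
  constructor
  · intro h
    let η : OneForm M EndV := rightForm f R - twoStarA S 0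
    have hη : IsMultiplier f η := by
      have hβ := isSmoothForm_barForm (hR.contMDiff hf)
      refine isMultiplier_of_basis ?_ ?_ ?_ ?_
      · exact ((((hβ.mulForm hf.1 mulL).mapForm _).add (hβ.mapForm _)).smul _).sub
          (isSmoothForm_twoStarA hS.smooth isSmoothForm_zero)
      · exact fun p X => (isQuatLinear_rightForm p X).sub
          (isQuatLinear_twoStarA hS.smooth hS.quatLinear (fun _ _ => isQuatLinear_zero) p X)
      · intro p X
        refine sub_mem ?_ (hS'.twoStarA_apply_infty_mem hf hN hR hH p X)
        change rightForm f R p X ![1, 0] ∈ line f p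
        rw [rightForm_apply, mem_line]
        simp
      · intro p X
        exact sub_eq_zero.2 (hS'.twoStarA_apply_lift hf hN hR hH (fun _ _ => rfl) p X).symm
    have he : twoStarA S η = rightForm f R := by
      simp only [twoStarA, η]
      abel
    rw [← he] at h
    refine ⟨⟨hf, S, hS, η, hη, h⟩, η, hη, h, fun p X v hv => ?_⟩
    rw [he, rightForm_apply, mem_lineInfty.1 hv]
    simp
  · rintro ⟨-, η, hη, hc, h0⟩
    have hη' (p : M) (X : ℂ) : η p X ![f p, 1] = 0 :=
      (hη.2 p X).2.2 _ (mem_line.2 (by simp))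
    convert hc using 1
    funext p
    refine ContinuousLinearMap.ext fun X => (isQuatLinear_rightForm p X).ext_basis
      (isQuatLinear_twoStarA hS.smooth hS.quatLinear (fun p X => (hη.2 p X).1) p X) (f p) ?_
      (hS'.twoStarA_apply_lift hf hN hR hH hη' p X).symm
    rw [h0 p X _ (mem_lineInfty.2 rfl), rightForm_apply]
    simp

lemma isHarmonic_leftNormal_iff (hf : IsConformalImmersion f) (hN : IsLeftNormal f N)
    (hR : IsRightNormal f R) (hS : IsMeanCurvatureSphere f S) :
    IsHarmonic N ↔ IsConstrainedWillmore f ∧ ∃ η, IsMultiplier f η ∧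
      IsClosedForm (twoStarQ S η) ∧ ∀ p X v, twoStarQ S η p X v ∈ lineInfty := by
  obtain ⟨H, hS', hH⟩ := hS.isSphereField hf hN hR
  rw [← isClosedForm_leftForm_iff hf hN]
  constructor
  · intro h
    let η : OneForm M EndV := leftForm f N - twoStarQ S 0
    have hη : IsMultiplier f η := by
      have hσ := isSmoothForm_barForm (hN.contMDiff hf)
      refine isMultiplier_of_basis ?_ ?_ ?_ ?_
      · exact (((hσ.mapForm _).add ((hσ.mulForm hf.1 _).mapForm _)).smul _).sub
          (isSmoothForm_twoStarQ hS.smooth isSmoothForm_zero)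
      · exact fun p X => (isQuatLinear_leftForm p X).sub
          (isQuatLinear_twoStarQ hS.smooth hS.quatLinear (fun _ _ => isQuatLinear_zero) p X)
      · intro p X
        have h1 := hS'.twoStarQ_apply_infty_mod_line (η := 0) hf hN hR hH (X := X)
          (zero_mem (line f p))
        change leftForm f N p X ![1, 0] - twoStarQ S 0 p X ![1, 0] ∈ _
        rw [mem_line, leftForm_apply]
        simp only [Pi.sub_apply, Pi.smul_apply, Matrix.cons_val_zero, Matrix.cons_val_one,
          mul_zero, sub_zero, mul_one, smul_zero, zero_sub, ← h1]
        noncomm_ring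
      · intro p X
        refine sub_eq_zero.2 ?_
        change leftForm f N p X ![f p, 1] = twoStarQ S 0 p X ![f p, 1]
        rw [hS'.twoStarQ_apply_lift hf hN hR hH (fun _ _ => rfl), leftForm_apply]
        simp
    have he : twoStarQ S η = leftForm f N := by
      simp only [twoStarQ, η]
      abel
    rw [← he] at h
    refine ⟨⟨hf, S, hS, η, hη, isClosedForm_twoStarA hS.smooth hη.1 h⟩, η, hη, h,
      fun p X v => ?_⟩
    rw [he, leftForm_apply, mem_lineInfty]
    simp
  · rintro ⟨-, η, hη, hc, h0⟩
    have hη' (p : M) (X : ℂ) : η p X ![f p, 1] = 0 :=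
      (hη.2 p X).2.2 _ (mem_line.2 (by simp))
    convert hc using 1
    funext p
    refine ContinuousLinearMap.ext fun X => (isQuatLinear_leftForm p X).ext_basis
      (isQuatLinear_twoStarQ hS.smooth hS.quatLinear (fun p X => (hη.2 p X).1) p X) (f p) ?_ ?_
    · have h1 := hS'.twoStarQ_apply_infty_mod_line hf hN hR hH ((hη.2 p X).2.1 ![1, 0])
      have h2 := mem_lineInfty.1 (h0 p X ![1, 0])
      rw [h2, mul_zero, sub_zero] at h1
      rw [leftForm_apply]
      ext1 i
      fin_cases i
      · simpa using h1.symm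
      · simpa using h2.symm
    · rw [hS'.twoStarQ_apply_lift hf hN hR hH hη', leftForm_apply]
      simp

lemma existsUnique_isMeanCurvatureSphere (hf : IsConformalImmersion f) :
    ∃! S, IsMeanCurvatureSphere f S := by
  obtain ⟨N, hN, -⟩ := existsUnique_isLeftNormal hf
  obtain ⟨R, hR, -⟩ := existsUnique_isRightNormal hf
  obtain ⟨H, hHs, hH⟩ := exists_isMeanCurvature hf hR
  obtain ⟨S, hS⟩ := exists_isSphereField hf.1 (hN.contMDiff hf) (hR.contMDiff hf) hHs
  refine ⟨S, hS.isMeanCurvatureSphere hf hN hR hH, fun S' hS' => ?_⟩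
  obtain ⟨H', h', hH'⟩ := hS'.isSphereField hf hN hR
  obtain rfl : H' = H := hH'.unique hf hH
  exact h'.eq_of_eq hS

end Main

end QuatSurface

end

theorem mainTheorem10 {M : Type*} [TopologicalSpace M] [ChartedSpace ℂ M] [IsManifold 𝓘(ℂ) ω M]
    (f : M → ℍ[ℝ]) (hf : IsConformalImmersion f) :
    (∃! N, IsLeftNormal f N) ∧ (∃! R, IsRightNormal f R) ∧ (∃! S, IsMeanCurvatureSphere f S) ∧
    ∀ N R S, IsLeftNormal f N → IsRightNormal f R → IsMeanCurvatureSphere f S →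
      (IsHarmonic R ↔
        IsConstrainedWillmore f ∧ ∃ η, IsMultiplier f η ∧ IsClosedForm (twoStarA S η) ∧
          ∀ p X, ∀ v ∈ lineInfty, twoStarA S η p X v = 0) ∧
      (IsHarmonic N ↔
        IsConstrainedWillmore f ∧ ∃ η, IsMultiplier f η ∧ IsClosedForm (twoStarQ S η) ∧
          ∀ p X v, twoStarQ S η p X v ∈ lineInfty) :=
  ⟨existsUnique_isLeftNormal hf, existsUnique_isRightNormal hf,
    existsUnique_isMeanCurvatureSphere hf, fun _ _ _ hN hR hS =>
      ⟨isHarmonic_rightNormal_iff hf hN hR hS, isHarmonic_leftNormal_iff hf hN hR hS⟩⟩
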